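/- \textbf{Setting.} Let $\mathcal S$ be a relational schema: a nonempty, possibly infinite domain $\mathcal U$ of constants and finitely many predicates. An instance is a finite set of ground atoms, seen as a Herbrand structure over $\mathcal U$. Let $D$ be an instance and $IC$ a finite set of universal constraints $\forall\bar x(\bigwedge_i P_i(\bar x_i)\rightarrow\bigvee_j Q_j(\bar y_j)\vee\varphi)$ with $P_i,Q_j\in\mathcal S$ and $\varphi$ a disjunction of literals $s=t$, $s\neq t$, all of whose variables occur in the atoms $P_i(\bar x_i)$. A repair of $D$ is an instance $D'\models IC$ for which the symmetric difference $\Delta(D,D')$ is inclusion-minimal. The tuple $\bar a\in\mathcal U$ is a consistent answer to the query $\mathcal Q$, written $D\models_c\mathcal Q(\bar a)$, if $D'\models\mathcal Q(\bar a)$ for every repair $D'$. The query $\mathcal Q(\bar x)$ is a Datalog$^{not}$ query, i.e. a safe, normal, stratified (e.g. non-recursive) program whose rule heads are intensional predicates, one of them being $Ans$; or a first-order query over $\mathcal S$ having on every instance the same answers as such a program. For a Datalog query, $D'\models\mathcal Q(\bar a)$ means that $Ans(\bar a)$ is true in the (unique) stable model of the program with the facts $D'$. Let $\Pi^{\mathcal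 Q}$ be this program with every $P\in\mathcal S$ replaced by a new predicate $P_{\star\star}$. The facts-free repair program $\Pi^r$ has, for each constraint in $IC$ and each partition of its atoms $\{Q_j\}$ into $Q',Q''$, the rule $$\bigvee_i P_{i\,\mathbf f}(\bar x_i)\vee\bigvee_j Q_{j\,\mathbf t}(\bar y_j)\leftarrow\bigwedge_i P_{i\,\star}(\bar x_i),\ \bigwedge_{Q_j\in Q'}Q_{j\,\mathbf f}(\bar y_j),\ \bigwedge_{Q_k\in Q''}not\ Q_k(\bar y_k),\ \neg\varphi ,$$ and, for each $P\in\mathcal S$, the rules $P_\star(\bar x)\leftarrow P(\bar x)$; $P_\star(\bar x)\leftarrow P_{\mathbf t}(\bar x)$; $P_{\star\star}(\bar x)\leftarrow P_\star(\bar x),not\ P_{\mathbf f}(\bar x)$; and $\leftarrow P_{\mathbf t}(\bar x),P_{\mathbf f}(\bar x)$. The combined program is $\Pi=D\cup\Pi^r\cup\Pi^{\mathcal Q}$. For a program $\Gamma$ let $\psi(\Gamma)$ be the conjunction of the universal closures of its rules $Body\to Head$, with $not\ N$ read as $N\to\bot$. For a list $\bar P$ of circumscribed predicates, $\Phi(\Gamma)$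 is the second-order sentence $\psi\wedge\neg\exists\bar X(\bar X<\bar P\wedge\psi^\circ(\bar X))$, where $\bar X<\bar P$ means that every $X^P$ is contained in $P$, at least one properly; $\psi^\circ$ replaces each atom $P(\bar t)$ of a circumscribed predicate by $X^P(\bar t)$, leaves $\bot$, equalities and atoms of the other predicates unchanged, commutes with $\wedge,\vee,\forall,\exists$, and $(F\to G)^\circ=(F^\circ\to G^\circ)\wedge(F\to G)$. All predicates are circumscribed in $\Phi(\Pi)$; the predicates $P_{\mathbf t},P_{\mathbf f},P_\star,P_{\star\star}$ ($P\in\mathcal S$) in $\Phi(\Pi^r)$; the intensional predicates of the query in $\Phi(\Pi^{\mathcal Q})$. Let $PC(D)$ be the conjunction of the predicate completions $\forall\bar x(P(\bar x)\equiv\bigvee_{\bar t\in P^D}\bar x=\bar t)$, $P\in\mathcal S$. For a finite nonempty $C\subseteq\mathcal U$, let $DCA_C$ be $\forall x\bigvee_{c\in C}x=c$, let $UNA_C$ be $\bigwedge_{c\ne c'\in C}c\neq c'$, and let $\mathcal R_C(D)=DCA_C\wedge UNA_C\wedge PC(D)$. \textbf{Proposition.} \begin{enumerate} \item Let $C\subseteq\mathcal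 U$ be finite and nonempty and contain the active domain of $D$ and all constants of $IC$ and $\Pi^{\mathcal Q}$ (e.g. $C=\mathcal U$ if $\mathcal U$ is finite). Then for every tuple $\bar a$ of elements of $C$ $$D\models_c\mathcal Q(\bar a)\iff\{\mathcal R_C(D),\Phi(\Pi^r),\Phi(\Pi^{\mathcal Q})\}\models Ans(\bar a),$$ where $\models$ is second-order consequence over all structures with nonempty domain. Moreover $DCA_C\wedge UNA_C\wedge\Phi(\Pi)$ is logically equivalent to $\mathcal R_C(D)\wedge\Phi(\Pi^r)\wedge\Phi(\Pi^{\mathcal Q})$. \item For every tuple $\bar a$ in $\mathcal U$, $D\models_c\mathcal Q(\bar a)$ iff $Ans(\bar a)$ holds in all Herbrand structures (with domain $\mathcal U$) that satisfy $PC(D)$, $\Phi(\Pi^r)$ and $\Phi(\Pi^{\mathcal Q})$. \item $\Phi(\Pi^r)$ specifies the repairs for fixed extensional predicates: the extensions of $(P_{\star\star})_{P\in\mathcal S}$ in the Herbrand models of $\Phi(\Pi^r)$ whose extensional predicates are given by $D$ are exactly the repairs of $D$. \item $\Phi(\Pi^{\mathcal Q})$ specifies the query answers for fixed predicates $P_{\star\star}$: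 for every instance $D'$, there is a Herbrand model of $\Phi(\Pi^{\mathcal Q})$ in which the predicates $P_{\star\star}$ are given by $D'$, and in every such model $Ans$ is exactly the set of answers to $\mathcal Q$ on $D'$. \end{enumerate} -/

import Mathlib

universe u v

namespace CQA

noncomputable section

/-! ### Signatures, terms, atoms -/

/-- A set of predicates with their arities. A relational schema, given together with a domain `U`
of constants, is such a set of (database) predicates. -/
structure Sig where
  Pred : Type v
  arity : Pred → ℕ

/-- The signature with the predicates of both arguments. -/
def Sig.sum (S A : Sig.{v}) : Sig.{v} := ⟨S.Pred ⊕ A.Pred, Sum.elim S.arity A.arity⟩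

/-- Terms are variables (from `V`) or constants (from `K`). -/
inductive Term (K : Type*) (V : Type*) where
  | var (x : V) : Term K V
  | cst (c : K) : Term K V

/-- Value of a term, given the values of the constants and of the variables. -/
def Term.eval {K V M : Type*} (k : K → M) (v : V → M) : Term K V → M
  | .var x => v x
  | .cst c => k c

/-- Renaming of variables. -/
def Term.rename {K V W : Type*} (f : V → W) : Term K V → Term K W
  | .var x => .var (f x)
  | .cst c => .cst c

/-- Database atoms `p(t₁, …, tₙ)`. -/
structure Atom (σ : Sig.{v}) (K : Type*) (V : Type*) where
  pred : σ.Pred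
  args : Fin (σ.arity pred) → Term K V

/-- Extensions for all the predicates of a signature, over the domain `M`. -/
abbrev Interp (σ : Sig.{v}) (M : Type*) := ∀ p : σ.Pred, Set (Fin (σ.arity p) → M)

/-- Truth of an atom. -/
def Atom.Holds {σ : Sig.{v}} {K V M : Type*} (k : K → M) (I : Interp σ M) (v : V → M)
    (a : Atom σ K V) : Prop :=
  (fun i => (a.args i).eval k v) ∈ I a.pred

/-- The constants that occur in an atom. -/
def Atom.consts {σ : Sig.{v}} {K V : Type*} (a : Atom σ K V) : Set K :=
  {c | ∃ i, a.args i = .cst c}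

/-- Built-in literals `s = t` and `s ≠ t`. -/
inductive Builtin (K : Type*) (V : Type*) where
  | eq (s t : Term K V) : Builtin K V
  | ne (s t : Term K V) : Builtin K V

/-- The complementary built-in literal. -/
def Builtin.compl {K V : Type*} : Builtin K V → Builtin K V
  | .eq s t => .ne s t
  | .ne s t => .eq s t

/-- Truth of a built-in literal. -/
def Builtin.Holds {K V M : Type*} (k : K → M) (v : V → M) : Builtin K V → Prop
  | .eq s t => s.eval k v = t.eval k v
  | .ne s t => s.eval k v ≠ t.eval k v

/-- The constants that occur in a built-in literal. -/
def Builtin.consts {K V : Type*} : Builtin K V → Set K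
  | .eq s t => {c | s = .cst c ∨ t = .cst c}
  | .ne s t => {c | s = .cst c ∨ t = .cst c}

/-! ### Instances, integrity constraints, repairs -/

/-- A database instance: a finite extension for every predicate of the schema. -/
abbrev Instance (S : Sig.{v}) (U : Type u) := ∀ p : S.Pred, Finset (Fin (S.arity p) → U)

/-- The extensions `(R^D)_R` of the predicates in the instance `D`. -/
def Instance.ext {S : Sig.{v}} {U : Type u} (D : Instance S U) : Interp S U := fun p => ↑(D p)

/-- The active domain of an instance. -/
def Instance.adom {S : Sig.{v}} {U : Type u} (D : Instance S U) : Set U :=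
  {c | ∃ p, ∃ t ∈ D p, ∃ i, t i = c}

/-- A universal constraint `∀ x̄ (⋀ᵢ Pᵢ(x̄ᵢ) → ⋁ⱼ Qⱼ(ȳⱼ) ∨ φ)`. The `Pᵢ` are listed in `pre`, the
`Qⱼ` in `post`, and `φ` is the disjunction of the built-in literals listed in `phi`. -/
structure UIC (S : Sig.{v}) (U : Type u) where
  nvars : ℕ
  pre : List (Atom S U (Fin nvars))
  post : List (Atom S U (Fin nvars))
  phi : List (Builtin U (Fin nvars))

/-- All the variables of the constraint occur in the atoms `Pᵢ`. -/
def UIC.Safe {S : Sig.{v}} {U : Type u} (κ : UIC S U) : Prop :=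
  ∀ x : Fin κ.nvars, ∃ a ∈ κ.pre, ∃ i, a.args i = .var x

/-- The constants that occur in a constraint. -/
def UIC.consts {S : Sig.{v}} {U : Type u} (κ : UIC S U) : Set U :=
  {c | (∃ a ∈ κ.pre, c ∈ a.consts) ∨ (∃ a ∈ κ.post, c ∈ a.consts) ∨ ∃ b ∈ κ.phi, c ∈ b.consts}

/-- `D ⊨ κ`, for the Herbrand structure with domain `U` given by `D`. -/
def Instance.Satisfies {S : Sig.{v}} {U : Type u} (D : Instance S U) (κ : UIC S U) : Prop :=
  ∀ v : Fin κ.nvars → U, (∀ a ∈ κ.pre, a.Holds id D.ext v) →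
    (∃ a ∈ κ.post, a.Holds id D.ext v) ∨ ∃ b ∈ κ.phi, b.Holds id v

/-- The symmetric difference `Δ(D, D')`. -/
def delta {S : Sig.{v}} {U : Type u} (D D' : Instance S U) : Interp S U :=
  fun p => symmDiff (D.ext p) (D'.ext p)

/-- `Rep(D, IC)`: the instances that satisfy `IC` and whose symmetric difference with `D` is
minimal with respect to set inclusion. -/
def Repairs {S : Sig.{v}} {U : Type u} (D : Instance S U) (IC : List (UIC S U)) :
    Set (Instance S U) :=
  {D' | (∀ κ ∈ IC, D'.Satisfies κ) ∧
    ∀ D'' : Instance S U, (∀ κ ∈ IC, D''.Satisfies κ) → delta D D'' ≤ delta D D' →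
      delta D D'' = delta D D'}

/-! ### Disjunctive Datalog programs with negation -/

/-- A rule `A₁ ∨ … ∨ Aₙ ← P₁, …, Pₘ, not N₁, …, not Nₖ, B₁, …, Bₗ`, with built-in literals `Bᵢ`
and with variables from `Fin nvars`. -/
structure Rule (σ : Sig.{v}) (K : Type*) where
  nvars : ℕ
  head : List (Atom σ K (Fin nvars))
  pos : List (Atom σ K (Fin nvars))
  neg : List (Atom σ K (Fin nvars))
  built : List (Builtin K (Fin nvars))

/-- Programs are finite collections of rules. -/
abbrev Program (σ : Sig.{v}) (K : Type*) := List (Rule σ K)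

/-- All the variables of the rule occur in positive database atoms of its body. -/
def Rule.Safe {σ : Sig.{v}} {K : Type*} (r : Rule σ K) : Prop :=
  ∀ x : Fin r.nvars, ∃ a ∈ r.pos, ∃ i, a.args i = .var x

/-- The constants that occur in a rule. -/
def Rule.consts {σ : Sig.{v}} {K : Type*} (r : Rule σ K) : Set K :=
  {c | (∃ a ∈ r.head, c ∈ a.consts) ∨ (∃ a ∈ r.pos, c ∈ a.consts) ∨
    (∃ a ∈ r.neg, c ∈ a.consts) ∨ ∃ b ∈ r.built, c ∈ b.consts}

/-- Translation of a rule along a translation of atoms. -/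
def Rule.map {σ τ : Sig.{v}} {K : Type*} (f : ∀ {n : ℕ}, Atom σ K (Fin n) → Atom τ K (Fin n))
    (r : Rule σ K) : Rule τ K where
  nvars := r.nvars
  head := r.head.map f
  pos := r.pos.map f
  neg := r.neg.map f
  built := r.built

/-- `N` is a model of the reduct, relative to `M`, of the ground version of the program. -/
def ReductModel {σ : Sig.{v}} {U : Type u} (P : Program σ U) (M N : Interp σ U) : Prop :=
  ∀ r ∈ P, ∀ v : Fin r.nvars → U,
    (∀ a ∈ r.neg, ¬ a.Holds id M v) → (∀ b ∈ r.built, b.Holds id v) →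
    (∀ a ∈ r.pos, a.Holds id N v) → ∃ a ∈ r.head, a.Holds id N v

/-- Stable models: `M` is a minimal model of the reduct of the program relative to `M`. -/
def StableModel {σ : Sig.{v}} {U : Type u} (P : Program σ U) (M : Interp σ U) : Prop :=
  ReductModel P M M ∧ ∀ N : Interp σ U, N ≤ M → ReductModel P M N → N = M

/-- Stratified programs: predicates that share a head have the same level, the level of a positive
body predicate is not larger, and that of a negated one smaller, than the level of the head. -/
def Stratified {σ : Sig.{v}} {K : Type*} (P : Program σ K) : Prop :=
  ∃ lv : σ.Pred → ℕ, ∀ r ∈ P, ∀ h ∈ r.head,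
    (∀ h' ∈ r.head, lv h'.pred = lv h.pred) ∧ (∀ b ∈ r.pos, lv b.pred ≤ lv h.pred) ∧
    ∀ b ∈ r.neg, lv b.pred < lv h.pred

/-- The instance as a set of program facts. -/
def Instance.facts {S : Sig.{v}} [Fintype S.Pred] {U : Type u} (D : Instance S U) : Program S U :=
  Finset.univ.toList.flatMap fun p : S.Pred => (D p).toList.map fun t =>
    { nvars := 0, head := [⟨p, fun i => .cst (t i)⟩], pos := [], neg := [], built := [] }

/-! ### Queries and consistent answers -/

/-- A database atom, as an atom of a Datalog query. -/
def Atom.edb {S A : Sig.{v}} {K V : Type*} (a : Atom S K V) : Atom (S.sum A) K V :=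
  ⟨.inl a.pred, a.args⟩

/-- A Datalog query program over the schema `S`, with intensional predicates `A`: its rules are
normal (one atom in the head), define intensional predicates, and are safe; the program is
stratified. -/
def IsQueryProgram {S A : Sig.{v}} {U : Type u} (P : Program (S.sum A) U) : Prop :=
  (∀ r ∈ P, ∃ h, r.head = [h] ∧ ∃ a : A.Pred, h.pred = .inr a) ∧ (∀ r ∈ P, r.Safe) ∧ Stratified P

/-- `b` is an answer to the Datalog query `P` with answer predicate `ans` on the instance `D`:
`ans(b)` is true in the stable model of `P` with the atoms of `D` as program facts. (The stable
model is unique for stratified normal programs.) -/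
def DatalogAnswer {S A : Sig.{v}} [Fintype S.Pred] {U : Type u} (P : Program (S.sum A) U)
    (ans : A.Pred) (D : Instance S U) (b : Fin (A.arity ans) → U) : Prop :=
  ∀ M : Interp (S.sum A) U, StableModel (D.facts.map (Rule.map Atom.edb) ++ P) M →
    b ∈ M (.inr ans)

/-- The first-order language `L(S)`: the predicates of the schema, and the elements of `U` as
constants. -/
def Sig.lang (S : Sig.{v}) (U : Type u) : FirstOrder.Language.{u, v} where
  Functions n := {_c : U // n = 0}
  Relations n := {p : S.Pred // S.arity p = n}

/-- An instance as a Herbrand structure for `L(S)`. -/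
@[reducible]
def Instance.herbrand {S : Sig.{v}} {U : Type u} (D : Instance S U) : (S.lang U).Structure U where
  funMap c _ := c.1
  RelMap p x := (fun i => x (Fin.cast p.2 i)) ∈ D p.1

/-- Queries: first-order queries in `L(S)`, or Datalog queries. The intensional predicate `ans`
of the query program fixes the number of answer variables. -/
inductive Query (S A : Sig.{v}) (ans : A.Pred) (U : Type u) where
  | fo (φ : (S.lang U).Formula (Fin (A.arity ans))) : Query S A ans U
  | datalog (P : Program (S.sum A) U) : Query S A ans U

/-- `D ⊨ Q(b)`. -/
def Query.Holds {S A : Sig.{v}} [Fintype S.Pred] {ans : A.Pred} {U : Type u} :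
    Query S A ans U → Instance S U → (Fin (A.arity ans) → U) → Prop
  | .fo φ, D, b => @FirstOrder.Language.Formula.Realize (S.lang U) U D.herbrand _ φ b
  | .datalog P, D, b => DatalogAnswer P ans D b

/-- The Datalog program `P` represents the query: it has the same answers as a first-order query on
every instance; it is the query itself if this is a Datalog program. -/
def Query.RepresentedBy {S A : Sig.{v}} [Fintype S.Pred] {ans : A.Pred} {U : Type u} :
    Query S A ans U → Program (S.sum A) U → Prop
  | .fo φ, P => ∀ (D : Instance S U) (b : Fin (A.arity ans) → U),
      (Query.fo φ : Query S A ans U).Holds D b ↔ DatalogAnswer P ans D b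
  | .datalog P', P => P' = P

/-- `D ⊨_c Q(b)`: `b` is a consistent answer to `Q` in `D` with respect to `IC`. -/
def ConsistentAnswer {S A : Sig.{v}} [Fintype S.Pred] {ans : A.Pred} {U : Type u}
    (IC : List (UIC S U)) (D : Instance S U) (Q : Query S A ans U)
    (b : Fin (A.arity ans) → U) : Prop :=
  ∀ D' ∈ Repairs D IC, Q.Holds D' b

/-! ### The combined program -/

/-- The predicates of the combined program: for every database predicate `P`, the predicates `P`,
`P_t`, `P_f`, `P_⋆` and `P_⋆⋆`; and the intensional predicates of the query. -/
inductive CQAPred (S A : Sig.{v}) : Type v where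
  | db (p : S.Pred) : CQAPred S A
  | tr (p : S.Pred) : CQAPred S A
  | fa (p : S.Pred) : CQAPred S A
  | st (p : S.Pred) : CQAPred S A
  | ss (p : S.Pred) : CQAPred S A
  | idb (a : A.Pred) : CQAPred S A

/-- The signature of the combined program. -/
def cqaSig (S A : Sig.{v}) : Sig.{v} where
  Pred := CQAPred S A
  arity
    | .db p | .tr p | .fa p | .st p | .ss p => S.arity p
    | .idb a => A.arity a

section Atoms

variable {S A : Sig.{v}} {K V : Type*}

/-- The atom `P(t̄)` in the signature of the combined program. -/
def Atom.db (a : Atom S K V) : Atom (cqaSig S A) K V := ⟨.db a.pred, a.args⟩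
/-- `P_t(t̄)`: the tuple is inserted. -/
def Atom.tr (a : Atom S K V) : Atom (cqaSig S A) K V := ⟨.tr a.pred, a.args⟩
/-- `P_f(t̄)`: the tuple is deleted. -/
def Atom.fa (a : Atom S K V) : Atom (cqaSig S A) K V := ⟨.fa a.pred, a.args⟩
/-- `P_⋆(t̄)`: the tuple is true or made true. -/
def Atom.st (a : Atom S K V) : Atom (cqaSig S A) K V := ⟨.st a.pred, a.args⟩
/-- `P_⋆⋆(t̄)`: the tuple is true in the repair. -/
def Atom.ss (a : Atom S K V) : Atom (cqaSig S A) K V := ⟨.ss a.pred, a.args⟩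

/-- Replacement of every database predicate `P` of a query atom by `P_⋆⋆`. -/
def Atom.starred : Atom (S.sum A) K V → Atom (cqaSig S A) K V
  | ⟨.inl p, ts⟩ => ⟨.ss p, ts⟩
  | ⟨.inr a, ts⟩ => ⟨.idb a, ts⟩

end Atoms

section Programs

variable {S : Sig.{v}} (A : Sig.{v}) {U : Type u}

/-- The repair rule of a constraint, for `Q' = J` and `Q''` its complement:
`⋁ᵢ Pᵢ_f ∨ ⋁ⱼ Qⱼ_t ← ⋀ᵢ Pᵢ_⋆, ⋀_{Qⱼ ∈ Q'} Qⱼ_f, ⋀_{Qₖ ∈ Q''} not Qₖ, ¬φ`. -/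
def UIC.repairRule (κ : UIC S U) (J : Finset (Fin κ.post.length)) : Rule (cqaSig S A) U where
  nvars := κ.nvars
  head := κ.pre.map Atom.fa ++ κ.post.map Atom.tr
  pos := κ.pre.map Atom.st ++ J.toList.map fun j => (κ.post.get j).fa
  neg := (Finset.univ \ J).toList.map fun j => (κ.post.get j).db
  built := κ.phi.map Builtin.compl

/-- The atom `p(x̄)` with pairwise distinct variables. -/
def genAtom (U : Type u) (p : S.Pred) : Atom S U (Fin (S.arity p)) := ⟨p, .var⟩

/-- The annotation rules `P_⋆(x̄) ← P(x̄)` and `P_⋆(x̄) ← P_t(x̄)`, the interpretation rule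
`P_⋆⋆(x̄) ← P_⋆(x̄), not P_f(x̄)` and the program constraint `← P_t(x̄), P_f(x̄)`. -/
def annotationRules (U : Type u) (p : S.Pred) : Program (cqaSig S A) U :=
  [{ nvars := S.arity p, head := [(genAtom U p).st], pos := [(genAtom U p).db],
     neg := [], built := [] },
   { nvars := S.arity p, head := [(genAtom U p).st], pos := [(genAtom U p).tr],
     neg := [], built := [] },
   { nvars := S.arity p, head := [(genAtom U p).ss], pos := [(genAtom U p).st],
     neg := [(genAtom U p).fa], built := [] },
   { nvars := S.arity p, head := [], pos := [(genAtom U p).tr, (genAtom U p).fa],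
     neg := [], built := [] }]

/-- The repair program without the database facts. -/
def repairProgram [Fintype S.Pred] (IC : List (UIC S U)) : Program (cqaSig S A) U :=
  (IC.flatMap fun κ => Finset.univ.toList.map (κ.repairRule A)) ++
    Finset.univ.toList.flatMap (annotationRules A U)

variable {A}

/-- The query program for consistent query answering: every database predicate `P` is replaced by
`P_⋆⋆`. -/
def queryProgram (P : Program (S.sum A) U) : Program (cqaSig S A) U :=
  P.map (Rule.map Atom.starred)

/-- The combined program: the facts, the repair program and the query program. -/
def cqaProgram [Fintype S.Pred] (D : Instance S U) (IC : List (UIC S U))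
    (P : Program (S.sum A) U) : Program (cqaSig S A) U :=
  D.facts.map (Rule.map Atom.db) ++ repairProgram A IC ++ queryProgram P

end Programs

/-! ### Second-order logic -/

/-- Second-order formulas over the predicates of `σ` and the constants in `K`; the individual
variables are natural numbers, and `pvar p` is a predicate variable `X^p` of the arity of `p`. -/
inductive SOFormula (σ : Sig.{v}) (K : Type u) where
  | bot : SOFormula σ K
  | eq (s t : Term K ℕ) : SOFormula σ K
  | rel (p : σ.Pred) (ts : Fin (σ.arity p) → Term K ℕ) : SOFormula σ K
  | pvar (p : σ.Pred) (ts : Fin (σ.arity p) → Term K ℕ) : SOFormula σ K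
  | and (F G : SOFormula σ K) : SOFormula σ K
  | or (F G : SOFormula σ K) : SOFormula σ K
  | imp (F G : SOFormula σ K) : SOFormula σ K
  | all (x : ℕ) (F : SOFormula σ K) : SOFormula σ K
  | ex (x : ℕ) (F : SOFormula σ K) : SOFormula σ K
  | allP (p : σ.Pred) (F : SOFormula σ K) : SOFormula σ K
  | exP (p : σ.Pred) (F : SOFormula σ K) : SOFormula σ K

/-- Structures with domain `M`. -/
structure Struct (σ : Sig.{v}) (K : Type u) (M : Type*) where
  cst : K → M
  rel : Interp σ M

namespace SOFormula

variable {σ : Sig.{v}} {K : Type u}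

open Classical in
/-- Tarskian truth, with full second-order quantifiers; `v` and `X` assign values to the individual
variables and to the predicate variables. -/
def Sat {M : Type*} (I : Struct σ K M) : (ℕ → M) → Interp σ M → SOFormula σ K → Prop
  | _, _, bot => False
  | v, _, eq s t => s.eval I.cst v = t.eval I.cst v
  | v, _, rel p ts => (fun i => (ts i).eval I.cst v) ∈ I.rel p
  | v, X, pvar p ts => (fun i => (ts i).eval I.cst v) ∈ X p
  | v, X, and F G => Sat I v X F ∧ Sat I v X G
  | v, X, or F G => Sat I v X F ∨ Sat I v X G
  | v, X, imp F G => Sat I v X F → Sat I v X G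
  | v, X, all x F => ∀ m : M, Sat I (Function.update v x m) X F
  | v, X, ex x F => ∃ m : M, Sat I (Function.update v x m) X F
  | v, X, allP p F => ∀ R : Set (Fin (σ.arity p) → M), Sat I v (Function.update X p R) F
  | v, X, exP p F => ∃ R : Set (Fin (σ.arity p) → M), Sat I v (Function.update X p R) F

/-- Negation: `¬ F` is `F → ⊥`. -/
def neg (F : SOFormula σ K) : SOFormula σ K := imp F bot

/-- Equivalence. -/
def iff (F G : SOFormula σ K) : SOFormula σ K := and (imp F G) (imp G F)

/-- Conjunction of a list (`⊥ → ⊥` if it is empty). -/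
def conj (l : List (SOFormula σ K)) : SOFormula σ K := l.foldr and (neg bot)

/-- Disjunction of a list (`⊥` if it is empty). -/
def disj (l : List (SOFormula σ K)) : SOFormula σ K := l.foldr or bot

/-- `∀ x₀ … ∀ xₙ₋₁ F`. -/
def allN : ℕ → SOFormula σ K → SOFormula σ K
  | 0, F => F
  | n + 1, F => allN n (all n F)

/-- `∃ x₀ … ∃ xₙ₋₁ F`. -/
def exN : ℕ → SOFormula σ K → SOFormula σ K
  | 0, F => F
  | n + 1, F => exN n (ex n F)

/-- `∃ X̄ F`, for the predicate variables `X^p` of the listed predicates. -/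
def exPs (l : List σ.Pred) (F : SOFormula σ K) : SOFormula σ K := l.foldr exP F

/-- `p(x₀, …, xₙ₋₁)`. -/
def relX (p : σ.Pred) : SOFormula σ K := rel p fun i => .var i

/-- `X^p(x₀, …, xₙ₋₁)`. -/
def pvarX (p : σ.Pred) : SOFormula σ K := pvar p fun i => .var i

/-- `X̄ < P̄` for the listed predicates `P̄`. -/
def lt (l : List σ.Pred) : SOFormula σ K :=
  and (conj (l.map fun p => allN (σ.arity p) (imp (pvarX p) (relX p))))
    (disj (l.map fun p => exN (σ.arity p) (and (relX p) (neg (pvarX p)))))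

open Classical in
/-- The formula `F°(X̄)` for a first-order formula `F` and the listed predicates. (The last three
cases do not arise from first-order formulas.) -/
def circ (l : List σ.Pred) : SOFormula σ K → SOFormula σ K
  | bot => bot
  | eq s t => eq s t
  | rel p ts => if p ∈ l then pvar p ts else rel p ts
  | and F G => and (circ l F) (circ l G)
  | or F G => or (circ l F) (circ l G)
  | imp F G => and (imp (circ l F) (circ l G)) (imp F G)
  | all x F => all x (circ l F)
  | ex x F => ex x (circ l F)
  | pvar p ts => pvar p ts
  | allP p F => allP p F
  | exP p F => exP p F

/-- The second-order sentence `ψ ∧ ¬ ∃ X̄ (X̄ < P̄ ∧ ψ°(X̄))` for the first-order sentence `ψ` and the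
list `P̄` of circumscribed predicates; all other predicates are fixed. -/
def stable (l : List σ.Pred) (ψ : SOFormula σ K) : SOFormula σ K :=
  and ψ (neg (exPs l (and (lt l) (circ l ψ))))

end SOFormula

/-- Truth of a sentence in a structure. -/
def Struct.Models {σ : Sig.{v}} {K : Type u} {M : Type*} (I : Struct σ K M)
    (F : SOFormula σ K) : Prop :=
  ∀ (v : ℕ → M) (X : Interp σ M), F.Sat I v X

/-- Logical consequence `T ⊨ F`. -/
def Entails {σ : Sig.{v}} {K : Type u} (T : Set (SOFormula σ K)) (F : SOFormula σ K) : Prop :=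
  ∀ (M : Type u) [Nonempty M] (I : Struct σ K M), (∀ G ∈ T, I.Models G) → I.Models F

/-- The Herbrand structure with the given extensions: the constants denote themselves. -/
def herbrand {σ : Sig.{v}} {U : Type u} (I : Interp σ U) : Struct σ U U := ⟨id, I⟩

/-- Logical consequence relative to Herbrand structures. -/
def HerbrandEntails {σ : Sig.{v}} {U : Type u} (T : Set (SOFormula σ U))
    (F : SOFormula σ U) : Prop :=
  ∀ I : Interp σ U, (∀ G ∈ T, (herbrand I).Models G) → (herbrand I).Models F

/-! ### The sentences -/

section Sentences

variable {σ : Sig.{v}} {K : Type u}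

/-- An atom of a rule as a formula. -/
def Atom.toFormula {n : ℕ} (a : Atom σ K (Fin n)) : SOFormula σ K :=
  .rel a.pred fun i => (a.args i).rename Fin.val

/-- A built-in literal of a rule as a formula. -/
def Builtin.toFormula {n : ℕ} : Builtin K (Fin n) → SOFormula σ K
  | .eq s t => .eq (s.rename Fin.val) (t.rename Fin.val)
  | .ne s t => .neg (.eq (s.rename Fin.val) (t.rename Fin.val))

/-- The universal closure of `Body → Head`. -/
def Rule.toFormula (r : Rule σ K) : SOFormula σ K :=
  .allN r.nvars (.imp
    (.conj (r.pos.map Atom.toFormula ++ r.neg.map (fun a => .neg a.toFormula) ++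
      r.built.map Builtin.toFormula))
    (.disj (r.head.map Atom.toFormula)))

/-- The first-order sentence `ψ(Π)` of a program. -/
def psi (P : Program σ K) : SOFormula σ K := .conj (P.map Rule.toFormula)

/-- The second-order sentence `Φ(Π)` of a program, for the list of circumscribed predicates. -/
def Phi (l : List σ.Pred) (P : Program σ K) : SOFormula σ K := .stable l (psi P)

/-- Domain closure axiom for the constants in `C`. -/
def DCA (σ : Sig.{v}) (C : Finset K) : SOFormula σ K :=
  .all 0 (.disj (C.toList.map fun c => .eq (.var 0) (.cst c)))

open Classical in
/-- Unique names axiom for the constants in `C`. -/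
def UNA (σ : Sig.{v}) (C : Finset K) : SOFormula σ K :=
  .conj (C.offDiag.toList.map fun c => .neg (.eq (.cst c.1) (.cst c.2)))

variable {S : Sig.{v}} (A : Sig.{v}) [Fintype S.Pred]

/-- Predicate completion: `∀ x̄ (P(x̄) ↔ ⋁_{t̄ ∈ P^D} x̄ = t̄)` for every database predicate `P`. -/
def completion (D : Instance S K) : SOFormula (cqaSig S A) K :=
  .conj (Finset.univ.toList.map fun p : S.Pred => .allN (S.arity p)
    (.iff (.relX (σ := cqaSig S A) (CQAPred.db p))
      (.disj ((D p).toList.map fun t =>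
        .conj (List.ofFn fun i : Fin (S.arity p) => .eq (.var i) (.cst (t i)))))))

/-- Reiter's logical reconstruction `R(D)` of the instance, with domain `C`: domain closure,
unique names and predicate completion. -/
def reiter (C : Finset K) (D : Instance S K) : SOFormula (cqaSig S A) K :=
  .and (DCA _ C) (.and (UNA _ C) (completion A D))

/-- The extensional predicates. -/
def dbPreds (S A : Sig.{v}) [Fintype S.Pred] : List (cqaSig S A).Pred :=
  Finset.univ.toList.map fun p : S.Pred => CQAPred.db p

/-- The predicates `P_t`, `P_f`, `P_⋆`, `P_⋆⋆`. -/
def repairPreds (S A : Sig.{v}) [Fintype S.Pred] : List (cqaSig S A).Pred :=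
  Finset.univ.toList.flatMap fun p : S.Pred => [CQAPred.tr p, .fa p, .st p, .ss p]

/-- The intensional predicates of the query. -/
def queryPreds (S A : Sig.{v}) [Fintype A.Pred] : List (cqaSig S A).Pred :=
  Finset.univ.toList.map fun a : A.Pred => CQAPred.idb a

/-- All the predicates of the combined program. -/
def allPreds (S A : Sig.{v}) [Fintype S.Pred] [Fintype A.Pred] : List (cqaSig S A).Pred :=
  dbPreds S A ++ repairPreds S A ++ queryPreds S A

/-- `Φ(Π^r)`: the extensional predicates `P` are fixed. -/
def PhiRepair (IC : List (UIC S K)) : SOFormula (cqaSig S A) K :=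
  Phi (repairPreds S A) (repairProgram A IC)

variable {A}

/-- `Φ(Π^Q)`: the predicates `P_⋆⋆` are fixed. -/
def PhiQuery [Fintype A.Pred] (P : Program (S.sum A) K) : SOFormula (cqaSig S A) K :=
  Phi (queryPreds S A) (queryProgram P)

/-- `Φ(Π)` for the combined program `Π`. -/
def PhiCQA [Fintype A.Pred] (D : Instance S K) (IC : List (UIC S K))
    (P : Program (S.sum A) K) : SOFormula (cqaSig S A) K :=
  Phi (allPreds S A) (cqaProgram D IC P)

/-- The sentence `Ans(b)`. -/
def ansFormula (S : Sig.{v}) (ans : A.Pred) (b : Fin (A.arity ans) → K) :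
    SOFormula (cqaSig S A) K :=
  .rel (σ := cqaSig S A) (CQAPred.idb ans) fun i => .cst (b i)

end Sentences

end

end CQA

open CQA

/-!
The sentence `Φ(Γ)` of a program `Γ` holds in a structure exactly if the structure is a stable model
of `Γ` relative to the circumscribed predicates, i.e. minimal, with the other predicates fixed, among
the models of its own reduct (`StableOn`, `models_Phi_iff`). The key point is that for `X̄ ≤ P̄` the
two conjuncts of `(N → ⊥)°` together just say that `N` is false in the structure, so that `ψ°(X̄)`
says that `X̄` is a model of the reduct. This holds over every domain and every interpretation of the
constants, and everything else is a statement about stable models.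

* A splitting theorem (`stableOn_append`) decomposes the combined program into the facts, whose stable
  models are described by the predicate completions, the repair program, and the query program
  (`stableOn_cqaProgram_iff`). It needs neither domain closure nor unique names.
* In a stable model of the repair program over `D`, the coherence constraint and minimality force
  `P_t` to consist of new tuples and `P_f` of tuples of `D`; since the constraints are safe, only
  constants of `D` and of the constraints occur, so that `P_⋆⋆ = (P ∪ P_t) \ P_f` is finite. The
  repair rules say that this set satisfies the constraints, and minimality of the model is minimality
  of the symmetric difference (`stableOn_repairProgram_iff`).
* A stratified normal program has exactly one stable model: the least model of the reduct, on the
  levels up to `n`, depends only on the levels below `n` of the interpretation that defines the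
  reduct, so that iterating this construction becomes constant (`existsUnique_stableModel`). Thus the
  query program, with `P_⋆⋆` fixed to an instance, has exactly one stable model, in which the answer
  predicate consists of the answers (`exists_stableOn_queryProgram`, `mem_answer_iff`).
* All programs are safe, so stability does not depend on additional domain elements (`stableOn_map`),
  and the values in the stable models of the combined program are constants of that program
  (`StableOn.mem_of_safe`). Hence the models of domain closure and unique names for `C` are the
  restrictions to `C` of the Herbrand stable models, which reduces second-order consequence over
  arbitrary structures to the Herbrand case (`entails_iff`).
-/

namespace CQA

/-! ### Stable models over arbitrary structures -/

section Semantics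

variable {σ : Sig.{v}} {K : Type u} {M : Type*}

/-- `ReductModel` over an arbitrary domain `M`, with `k` as the interpretation of the constants:
negated atoms are evaluated in `I`, positive ones in `N`. -/
def ReductSat (k : K → M) (P : Program σ K) (I N : Interp σ M) : Prop :=
  ∀ r ∈ P, ∀ w : Fin r.nvars → M,
    (∀ a ∈ r.neg, ¬ a.Holds k I w) → (∀ b ∈ r.built, b.Holds k w) →
    (∀ a ∈ r.pos, a.Holds k N w) → ∃ a ∈ r.head, a.Holds k N w

/-- `I` is a stable model of `P` relative to the predicates in `l`: it is minimal among the models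
of its reduct that have the same extensions outside `l`. -/
def StableOn (k : K → M) (l : Set σ.Pred) (P : Program σ K) (I : Interp σ M) : Prop :=
  ReductSat k P I I ∧
    ∀ N : Interp σ M, N ≤ I → (∀ p ∉ l, N p = I p) → ReductSat k P I N → N = I

theorem stableModel_iff_stableOn {U : Type u} {P : Program σ U} {I : Interp σ U} :
    StableModel P I ↔ StableOn id Set.univ P I := by
  simp only [StableModel, StableOn, Set.mem_univ, not_true_eq_false, false_imp_iff, imp_true_iff,
    true_imp_iff]
  rfl

theorem Atom.Holds.mono {V : Type*} {k : K → M} {I J : Interp σ M} (h : I ≤ J) {w : V → M}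
    {a : Atom σ K V} (ha : a.Holds k I w) : a.Holds k J w :=
  h a.pred ha

theorem Atom.holds_congr {V : Type*} {k : K → M} {I J : Interp σ M} {w : V → M}
    {a : Atom σ K V} (h : I a.pred = J a.pred) : a.Holds k I w ↔ a.Holds k J w := by
  simp only [Atom.Holds, h]

theorem reductSat_append {k : K → M} {P₁ P₂ : Program σ K} {I N : Interp σ M} :
    ReductSat k (P₁ ++ P₂) I N ↔ ReductSat k P₁ I N ∧ ReductSat k P₂ I N := by
  simp only [ReductSat, List.mem_append, or_imp, forall_and]

end Semantics

/-! ### Truth of the second-order sentences -/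

theorem exists_mem_map {α β : Type*} {f : α → β} {L : List α} {p : β → Prop} :
    (∃ b ∈ L.map f, p b) ↔ ∃ a ∈ L, p (f a) := by
  simp

namespace SOFormula

section Sat

variable {σ : Sig.{v}} {K : Type u} {M : Type*} {I : Struct σ K M} {v : ℕ → M} {X : Interp σ M}

theorem sat_conj {L : List (SOFormula σ K)} :
    (conj L).Sat I v X ↔ ∀ F ∈ L, F.Sat I v X := by
  induction L with
  | nil => simp [conj, neg, Sat]
  | cons F L ih =>
    rw [List.forall_mem_cons, ← ih]
    rfl

theorem sat_disj {L : List (SOFormula σ K)} :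
    (disj L).Sat I v X ↔ ∃ F ∈ L, F.Sat I v X := by
  induction L with
  | nil => simp [disj, Sat]
  | cons F L ih =>
    simp only [List.mem_cons, exists_eq_or_imp, ← ih]
    rfl

theorem sat_circ_conj {l : List σ.Pred} {L : List (SOFormula σ K)} :
    (circ l (conj L)).Sat I v X ↔ ∀ F ∈ L, (circ l F).Sat I v X := by
  induction L with
  | nil => simp [conj, neg, circ, Sat]
  | cons F L ih =>
    rw [List.forall_mem_cons, ← ih]
    rfl

theorem sat_circ_disj {l : List σ.Pred} {L : List (SOFormula σ K)} :
    (circ l (disj L)).Sat I v X ↔ ∃ F ∈ L, (circ l F).Sat I v X := by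
  induction L with
  | nil => simp [disj, circ, Sat]
  | cons F L ih =>
    simp only [List.mem_cons, exists_eq_or_imp, ← ih]
    rfl

theorem circ_allN (l : List σ.Pred) (n : ℕ) (F : SOFormula σ K) :
    circ l (allN n F) = allN n (circ l F) := by
  induction n generalizing F with
  | zero => rfl
  | succ n ih => exact ih _

/-- The variables that `allN` binds are the first `n`; the values of the others are kept. -/
theorem sat_allN_aux {n : ℕ} {F : SOFormula σ K} :
    (allN n F).Sat I v X ↔ ∀ v' : ℕ → M, (∀ i, n ≤ i → v' i = v i) → F.Sat I v' X := by
  induction n generalizing F with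
  | zero =>
    refine ⟨fun h v' hv => ?_, fun h => h v fun _ _ => rfl⟩
    obtain rfl : v' = v := funext fun i => hv i i.zero_le
    exact h
  | succ n ih =>
    refine ih.trans ⟨fun h v' hv => ?_, fun h v' hv m => h _ fun i hi => ?_⟩
    · have := h (Function.update v' n (v n)) (fun i hi => ?_) (v' n)
      · simpa using this
      · rcases eq_or_ne i n with rfl | hne
        · simp
        · rw [Function.update_of_ne hne, hv i (by omega)]
    · rw [Function.update_of_ne (by omega), hv i (by omega)]

theorem sat_exN_aux {n : ℕ} {F : SOFormula σ K} :
    (exN n F).Sat I v X ↔ ∃ v' : ℕ → M, (∀ i, n ≤ i → v' i = v i) ∧ F.Sat I v' X := by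
  induction n generalizing F with
  | zero =>
    refine ⟨fun h => ⟨v, fun _ _ => rfl, h⟩, fun ⟨v', hv, h⟩ => ?_⟩
    obtain rfl : v' = v := funext fun i => hv i i.zero_le
    exact h
  | succ n ih =>
    refine ih.trans ⟨fun ⟨v', hv, m, h⟩ => ⟨_, fun i hi => ?_, h⟩, fun ⟨v', hv, h⟩ => ?_⟩
    · rw [Function.update_of_ne (by omega), hv i (by omega)]
    · refine ⟨Function.update v' n (v n), fun i hi => ?_, v' n, by simpa using h⟩
      rcases eq_or_ne i n with rfl | hne
      · simp
      · rw [Function.update_of_ne hne, hv i (by omega)]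

/-- The assignment that takes the values `w` on the first `n` variables and agrees with `v` on the
others. -/
def extend {n : ℕ} (w : Fin n → M) (v : ℕ → M) (i : ℕ) : M := if h : i < n then w ⟨i, h⟩ else v i

theorem extend_val {n : ℕ} (w : Fin n → M) (v : ℕ → M) (i : Fin n) : extend w v i = w i := by
  simp [extend]

theorem extend_comp_val {n : ℕ} (w : Fin n → M) (v : ℕ → M) :
    (fun i : Fin n => extend w v i) = w :=
  funext (extend_val w v)

theorem eq_extend {n : ℕ} {v v' : ℕ → M} (h : ∀ i, n ≤ i → v' i = v i) :
    v' = extend (fun i : Fin n => v' i) v := by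
  funext i
  by_cases hi : i < n
  · simp [extend, hi]
  · simp [extend, hi, h i (by omega)]

theorem extend_of_le {n : ℕ} (w : Fin n → M) (v : ℕ → M) (i : ℕ) (hi : n ≤ i) :
    extend w v i = v i := by
  simp [extend, Nat.not_lt.2 hi]

theorem sat_allN {n : ℕ} {F : SOFormula σ K} :
    (allN n F).Sat I v X ↔ ∀ w : Fin n → M, F.Sat I (extend w v) X := by
  refine sat_allN_aux.trans ⟨fun h w => h _ (extend_of_le w v), fun h v' hv => ?_⟩
  rw [eq_extend hv]
  exact h _

theorem sat_exN {n : ℕ} {F : SOFormula σ K} :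
    (exN n F).Sat I v X ↔ ∃ w : Fin n → M, F.Sat I (extend w v) X := by
  refine sat_exN_aux.trans ⟨fun ⟨v', hv, h⟩ => ⟨fun i => v' i, ?_⟩,
    fun ⟨w, h⟩ => ⟨_, extend_of_le w v, h⟩⟩
  rwa [← eq_extend hv]

theorem sat_exPs {l : List σ.Pred} {F : SOFormula σ K} :
    (exPs l F).Sat I v X ↔ ∃ Y : Interp σ M, (∀ p ∉ l, Y p = X p) ∧ F.Sat I v Y := by
  classical
  induction l generalizing X with
  | nil =>
    refine ⟨fun h => ⟨X, fun _ _ => rfl, h⟩, fun ⟨Y, hY, h⟩ => ?_⟩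
    obtain rfl : Y = X := funext fun p => hY p List.not_mem_nil
    exact h
  | cons q l ih =>
    change (∃ R, (exPs l F).Sat I v (Function.update X q R)) ↔ _
    simp only [ih, List.mem_cons, not_or]
    constructor
    · rintro ⟨R, Y, hY, h⟩
      refine ⟨Y, fun p hp => ?_, h⟩
      rw [hY p hp.2]
      convert Function.update_of_ne hp.1 R X
    · rintro ⟨Y, hY, h⟩
      refine ⟨Y q, Y, fun p hp => ?_, h⟩
      rcases eq_or_ne p q with rfl | hne
      · convert (Function.update_self p (Y p) X).symm
      · rw [hY p ⟨hne, hp⟩]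
        convert (Function.update_of_ne hne (Y q) X).symm

theorem sat_lt {l : List σ.Pred} :
    (lt l).Sat I v X ↔ (∀ p ∈ l, X p ⊆ I.rel p) ∧ ∃ p ∈ l, ¬ I.rel p ⊆ X p := by
  change (conj _).Sat I v X ∧ (disj _).Sat I v X ↔ _
  simp only [sat_conj, sat_disj, List.forall_mem_map, exists_mem_map, sat_allN, sat_exN]
  refine and_congr (forall₂_congr fun p _ => forall_congr' fun w => ?_)
    (exists_congr fun p => and_congr_right fun _ => ?_)
  · simp only [Sat, pvarX, relX, Term.eval, extend_comp_val]
  · simp only [Sat, pvarX, relX, neg, Term.eval, extend_comp_val, Set.not_subset]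

end Sat

end SOFormula

section Phi

variable {σ : Sig.{v}} {K : Type u} {M : Type*} {I : Struct σ K M} {v : ℕ → M} {X : Interp σ M}

open SOFormula

theorem Term.eval_rename {V W : Type*} (k : K → M) (f : V → W) (w : W → M) (t : Term K V) :
    (t.rename f).eval k w = t.eval k fun x => w (f x) := by
  cases t <;> rfl

open Classical in
/-- The extensions that `F°(X̄)` refers to: those of `X̄` for the circumscribed predicates, and those
of the structure for the others. -/
def mixed (l : List σ.Pred) (X J : Interp σ M) : Interp σ M := fun p => if p ∈ l then X p else J p

theorem Atom.sat_toFormula {n : ℕ} {w : Fin n → M} {a : Atom σ K (Fin n)} :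
    a.toFormula.Sat I (extend w v) X ↔ a.Holds I.cst I.rel w := by
  simp only [Atom.toFormula, Sat, Term.eval_rename, extend_val]
  rfl

theorem Atom.sat_circ_toFormula {l : List σ.Pred} {n : ℕ} {w : Fin n → M} {a : Atom σ K (Fin n)} :
    (circ l a.toFormula).Sat I (extend w v) X ↔ a.Holds I.cst (mixed l X I.rel) w := by
  by_cases h : a.pred ∈ l
  · simp only [Atom.toFormula, circ, h, if_true, Sat, Term.eval_rename, extend_val, Atom.Holds,
      mixed]
  · simp only [Atom.toFormula, circ, h, if_false, Sat, Term.eval_rename, extend_val, Atom.Holds,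
      mixed]

theorem Builtin.sat_toFormula {n : ℕ} {w : Fin n → M} {b : Builtin K (Fin n)} :
    b.toFormula.Sat I (extend w v) X ↔ b.Holds I.cst w := by
  cases b <;>
    simp only [Builtin.toFormula, SOFormula.neg, Sat, Term.eval_rename, extend_val] <;> rfl

theorem Builtin.sat_circ_toFormula {l : List σ.Pred} {n : ℕ} {w : Fin n → M}
    {b : Builtin K (Fin n)} :
    (circ l b.toFormula).Sat I (extend w v) X ↔ b.Holds I.cst w := by
  cases b <;>
    simp only [Builtin.toFormula, SOFormula.neg, circ, Sat, Term.eval_rename, extend_val, and_self]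
      <;> rfl

theorem sat_psi {P : Program σ K} :
    (psi P).Sat I v X ↔ ReductSat I.cst P I.rel I.rel := by
  simp only [psi, sat_conj, List.forall_mem_map, Rule.toFormula, sat_allN]
  refine forall₂_congr fun r _ => forall_congr' fun w => ?_
  simp only [Sat, SOFormula.neg, sat_conj, sat_disj, List.forall_mem_append, List.forall_mem_map,
    exists_mem_map, Atom.sat_toFormula, Builtin.sat_toFormula]
  tauto

/-- For `X̄ ≤ P̄` the formula `ψ(Π)°(X̄)` expresses that `X̄` is a model of the reduct of `Π`: the
two conjuncts of `(N → ⊥)°` together say that `N` is false in the structure. -/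
theorem sat_circ_psi {l : List σ.Pred} {P : Program σ K}
    (hX : mixed l X I.rel ≤ I.rel) (hI : ReductSat I.cst P I.rel I.rel) :
    (circ l (psi P)).Sat I v X ↔ ReductSat I.cst P I.rel (mixed l X I.rel) := by
  rw [psi, sat_circ_conj, List.forall_mem_map]
  refine forall₂_congr fun r hr => ?_
  rw [Rule.toFormula, circ_allN, sat_allN]
  refine forall_congr' fun w => ?_
  have hIr := hI r hr w
  simp only [circ, Sat, SOFormula.neg, sat_conj, sat_disj, sat_circ_conj, sat_circ_disj,
    List.forall_mem_append, List.forall_mem_map, exists_mem_map, Atom.sat_toFormula,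
    Builtin.sat_toFormula, Atom.sat_circ_toFormula, Builtin.sat_circ_toFormula]
  have hneg : ∀ a : Atom σ K (Fin r.nvars),
      ((a.Holds I.cst (mixed l X I.rel) w → False) ∧ (a.Holds I.cst I.rel w → False)) ↔
        ¬ a.Holds I.cst I.rel w :=
    fun a => ⟨fun h => h.2, fun h => ⟨fun h' => h (h'.mono hX), h⟩⟩
  simp only [hneg]
  tauto

/-- The sentence `Φ(Π)` says that the structure is a stable model of `Π`. -/
theorem models_Phi_iff [Nonempty M] {l : List σ.Pred} {P : Program σ K} :
    I.Models (Phi l P) ↔ StableOn I.cst {p | p ∈ l} P I.rel := by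
  have key : ∀ (v : ℕ → M) (X : Interp σ M),
      (Phi l P).Sat I v X ↔ StableOn I.cst {p | p ∈ l} P I.rel := by
    intro v X
    change (psi P).Sat I v X ∧ ((exPs l _).Sat I v X → False) ↔ _
    rw [sat_psi, sat_exPs]
    refine and_congr_right fun hI => ⟨fun h N hN hoff hred => ?_, fun h => ?_⟩
    · by_contra hne
      have hmix : mixed l (mixed l N X) I.rel = N := by
        funext p
        by_cases hp : p ∈ l
        · simp [mixed, hp]
        · simp [mixed, hp, hoff p hp]
      refine h ⟨mixed l N X, fun p hp => by simp [mixed, hp], sat_lt.2 ⟨fun p hp => ?_, ?_⟩, ?_⟩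
      · simpa [mixed, hp] using hN p
      · by_contra! hall
        refine hne (le_antisymm hN fun p => ?_)
        by_cases hp : p ∈ l
        · simpa [mixed, hp] using hall p hp
        · exact (hoff p hp).ge
      · rw [sat_circ_psi (hmix.symm ▸ hN) hI, hmix]
        exact hred
    · rintro ⟨Y, -, hlt, hcirc⟩
      obtain ⟨hle, p, hp, hnot⟩ := sat_lt.1 hlt
      have hmix : mixed l Y I.rel ≤ I.rel := by
        intro q
        by_cases hq : q ∈ l
        · simpa [mixed, hq] using hle q hq
        · simp [mixed, hq]
      have := h _ hmix (fun q hq => if_neg hq) ((sat_circ_psi hmix hI).1 hcirc)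
      refine hnot ?_
      rw [← this]
      simp [mixed, hp]
  refine ⟨fun h => (key (fun _ => Classical.arbitrary M) I.rel).1 (h _ _),
    fun h v X => (key v X).2 h⟩

end Phi

/-! ### Splitting programs -/

section Splitting

variable {σ : Sig.{v}} {K : Type u} {M : Type*} {k : K → M} {I : Interp σ M}

/-- A splitting theorem: if the rules of `P₁` mention the predicates in `l₂` at most negated, and
neither program defines predicates assigned to the other, then the stable models of the union are
the common stable models of the parts. -/
theorem stableOn_append {l₁ l₂ : Set σ.Pred} {P₁ P₂ : Program σ K}
    (h₁ : ∀ r ∈ P₁, ∀ a ∈ r.head, a.pred ∉ l₂) (h₂ : ∀ r ∈ P₂, ∀ a ∈ r.head, a.pred ∉ l₁)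
    (hb : ∀ r ∈ P₁, ∀ a ∈ r.pos, a.pred ∉ l₂) :
    StableOn k (l₁ ∪ l₂) (P₁ ++ P₂) I ↔ StableOn k l₁ P₁ I ∧ StableOn k l₂ P₂ I := by
  classical
  -- A rule whose head predicates are not affected by shrinking `I` to `N` stays true.
  have keep : ∀ {l : Set σ.Pred} {P : Program σ K} {N : Interp σ M},
      (∀ r ∈ P, ∀ a ∈ r.head, a.pred ∉ l) → N ≤ I → (∀ p ∉ l, N p = I p) →
        ReductSat k P I I → ReductSat k P I N := by
    intro l P N hh hN hoff hI r hr w hneg hbuilt hpos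
    obtain ⟨a, ha, h⟩ := hI r hr w hneg hbuilt fun a ha => (hpos a ha).mono hN
    exact ⟨a, ha, (Atom.holds_congr (hoff _ (hh r hr a ha))).2 h⟩
  constructor
  · rintro ⟨hI, hmin⟩
    obtain ⟨hI₁, hI₂⟩ := reductSat_append.1 hI
    exact ⟨⟨hI₁, fun N hN hoff hred => hmin N hN (fun p hp => hoff p fun h => hp (.inl h))
        (reductSat_append.2 ⟨hred, keep h₂ hN hoff hI₂⟩)⟩,
      ⟨hI₂, fun N hN hoff hred => hmin N hN (fun p hp => hoff p fun h => hp (.inr h))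
        (reductSat_append.2 ⟨keep h₁ hN hoff hI₁, hred⟩)⟩⟩
  · rintro ⟨⟨hI₁, hmin₁⟩, ⟨hI₂, hmin₂⟩⟩
    refine ⟨reductSat_append.2 ⟨hI₁, hI₂⟩, fun N hN hoff hred => ?_⟩
    obtain ⟨hred₁, hred₂⟩ := reductSat_append.1 hred
    -- Restoring the predicates in `l₂` yields a model of the reduct of `P₁`, hence `I`.
    let N₁ : Interp σ M := fun p => if p ∈ l₂ then I p else N p
    have hle : N ≤ N₁ := fun p => by
      by_cases hp : p ∈ l₂
      · simpa [N₁, hp] using hN p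
      · simp [N₁, hp]
    have hN₁ : N₁ = I := by
      refine hmin₁ N₁ (fun p => ?_) (fun p hp => ?_) fun r hr w hneg hbuilt hpos => ?_
      · by_cases hp : p ∈ l₂
        · simp [N₁, hp]
        · simpa [N₁, hp] using hN p
      · by_cases hp₂ : p ∈ l₂
        · simp [N₁, hp₂]
        · simpa [N₁, hp₂] using hoff p (by simp [hp, hp₂])
      · obtain ⟨a, ha, h⟩ := hred₁ r hr w hneg hbuilt fun a ha =>
          (Atom.holds_congr (if_neg (hb r hr a ha))).1 (hpos a ha)
        exact ⟨a, ha, h.mono hle⟩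
    refine hmin₂ N hN (fun p hp => ?_) hred₂
    rw [← hN₁]
    exact (if_neg hp).symm

/-- If the models of the reduct of `F` are the interpretations that contain given tuples for the
predicates `c p`, then these are the only tuples in the stable model. -/
theorem stableOn_range_iff {ι : Type*} {c : ι → σ.Pred} (hc : Function.Injective c)
    {T : ∀ p, Set (Fin (σ.arity (c p)) → M)} {F : Program σ K}
    (hF : ∀ N, ReductSat k F I N ↔ ∀ p, T p ⊆ N (c p)) :
    StableOn k (Set.range c) F I ↔ ∀ p, I (c p) = T p := by
  constructor
  · rintro ⟨hI, hmin⟩ p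
    refine subset_antisymm (fun t ht => ?_) ((hF I).1 hI p)
    let N : Interp σ M := fun q => {t ∈ I q | q ∈ Set.range c →
      ∃ p, ∃ s ∈ T p, (⟨c p, s⟩ : Σ q, Fin (σ.arity q) → M) = ⟨q, t⟩}
    have hN : N = I := by
      refine hmin N (fun q t ht => ht.1) (fun q hq => ?_) ((hF N).2 fun p s hs => ?_)
      · exact subset_antisymm (fun t ht => ht.1) fun t ht => ⟨ht, fun h => (hq h).elim⟩
      · exact ⟨(hF I).1 hI p hs, fun _ => ⟨p, s, hs, rfl⟩⟩
    rw [← hN] at ht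
    obtain ⟨p', s, hs, heq⟩ := ht.2 ⟨p, rfl⟩
    obtain rfl : p' = p := hc (congrArg Sigma.fst heq)
    rwa [← eq_of_heq (Sigma.mk.inj heq).2]
  · intro h
    refine ⟨(hF I).2 fun p => (h p).ge, fun N hN hoff hred => le_antisymm hN fun q => ?_⟩
    by_cases hq : q ∈ Set.range c
    · obtain ⟨p, rfl⟩ := hq
      exact (h p).le.trans ((hF N).1 hred p)
    · exact (hoff q hq).ge

end Splitting

/-! ### Database facts -/

section Facts

variable {S A : Sig.{v}} {U : Type u} {M : Type*}

/-- The tuples of the instance, evaluated in a structure. -/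
def Instance.eval (k : U → M) (D : Instance S U) : Interp S M := fun p => (fun t => k ∘ t) '' D p

theorem Instance.eval_id (D : Instance S U) : D.eval id = D.ext := by
  funext p
  simp [Instance.eval, Instance.ext]

variable [Fintype S.Pred]

theorem mem_facts_map {σ : Sig.{v}} {D : Instance S U}
    {f : ∀ {n : ℕ}, Atom S U (Fin n) → Atom σ U (Fin n)} {r : Rule σ U} :
    r ∈ D.facts.map (Rule.map f) ↔
      ∃ p, ∃ t ∈ D p, r = ⟨0, [f ⟨p, fun i => .cst (t i)⟩], [], [], []⟩ := by
  simp only [Instance.facts, List.mem_map, List.mem_flatMap, Finset.mem_toList, Finset.mem_univ,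
    true_and]
  constructor
  · rintro ⟨_, ⟨p, t, ht, rfl⟩, rfl⟩
    exact ⟨p, t, ht, rfl⟩
  · rintro ⟨p, t, ht, rfl⟩
    exact ⟨_, ⟨p, t, ht, rfl⟩, rfl⟩

theorem reductSat_facts_map {σ : Sig.{v}} {D : Instance S U}
    {f : ∀ {n : ℕ}, Atom S U (Fin n) → Atom σ U (Fin n)} {k : U → M} {I N : Interp σ M} :
    ReductSat k (D.facts.map (Rule.map f)) I N ↔
      ∀ p, ∀ t ∈ D p, ∀ w : Fin 0 → M, (f ⟨p, fun i => .cst (t i)⟩).Holds k N w := by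
  constructor
  · intro h p t ht w
    obtain ⟨a, ha, hN⟩ := h _ (mem_facts_map.2 ⟨p, t, ht, rfl⟩) w (by simp) (by simp) (by simp)
    rwa [List.mem_singleton.1 ha] at hN
  · intro h r hr w _ _ _
    obtain ⟨p, t, ht, rfl⟩ := mem_facts_map.1 hr
    exact ⟨_, List.mem_singleton_self _, h p t ht w⟩

theorem stableOn_facts_db {D : Instance S U} {k : U → M} {I : Interp (cqaSig S A) M} :
    StableOn k (Set.range CQAPred.db) (D.facts.map (Rule.map Atom.db)) I ↔
      ∀ p, I (.db p) = D.eval k p := by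
  refine stableOn_range_iff (σ := cqaSig S A) (c := CQAPred.db) (T := D.eval k)
    (fun p q h => CQAPred.db.inj h) fun N => ?_
  rw [reductSat_facts_map]
  refine forall_congr' fun p => ⟨?_, fun h t ht w => h ⟨t, ht, rfl⟩⟩
  rintro h _ ⟨t, ht, rfl⟩
  exact h t ht finZeroElim

theorem stableOn_facts_edb {D : Instance S U} {k : U → M} {I : Interp (S.sum A) M} :
    StableOn k (Set.range Sum.inl) (D.facts.map (Rule.map Atom.edb)) I ↔
      ∀ p, I (.inl p) = D.eval k p := by
  refine stableOn_range_iff (σ := S.sum A) (c := Sum.inl) (T := D.eval k)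
    Sum.inl_injective fun N => ?_
  rw [reductSat_facts_map]
  refine forall_congr' fun p => ⟨?_, fun h t ht w => h ⟨t, ht, rfl⟩⟩
  rintro h _ ⟨t, ht, rfl⟩
  exact h t ht finZeroElim

open SOFormula in
theorem models_completion [Nonempty M] {D : Instance S U} {I : Struct (cqaSig S A) U M} :
    I.Models (completion A D) ↔ ∀ p, I.rel (CQAPred.db p) = D.eval I.cst p := by
  have key : ∀ (v : ℕ → M) (X : Interp (cqaSig S A) M),
      (completion A D).Sat I v X ↔ ∀ p, I.rel (CQAPred.db p) = D.eval I.cst p := by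
    intro v X
    simp only [completion, sat_conj, List.forall_mem_map, Finset.mem_toList, Finset.mem_univ,
      true_imp_iff, sat_allN]
    refine forall_congr' fun p => ?_
    refine Iff.trans (forall_congr' fun w => ?_) Set.ext_iff.symm
    have h₁ : (relX (σ := cqaSig S A) (K := U) (CQAPred.db p)).Sat I (extend w v) X ↔
        w ∈ I.rel (CQAPred.db p) := by
      change (fun i : Fin (S.arity p) => extend w v i) ∈ I.rel (CQAPred.db p) ↔ _
      rw [extend_comp_val]
    have h₂ : (disj ((D p).toList.map fun t => conj (List.ofFn fun i : Fin (S.arity p) =>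
        (SOFormula.eq (.var i) (.cst (t i)) : SOFormula (cqaSig S A) U)))).Sat I (extend w v) X ↔
        w ∈ D.eval I.cst p := by
      simp only [sat_disj, exists_mem_map, sat_conj, Finset.mem_toList, List.forall_mem_ofFn_iff,
        Sat, Term.eval, extend_val]
      exact exists_congr fun t => and_congr_right fun _ =>
        ⟨fun h => (funext h).symm, fun h i => (congrFun h i).symm⟩
    change (_ → _) ∧ (_ → _) ↔ _
    rw [h₁, h₂, ← iff_iff_implies_and_implies]
    rfl
  exact ⟨fun h => (key (fun _ => Classical.arbitrary M) I.rel).1 (h _ _),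
    fun h v X => (key v X).2 h⟩

end Facts

/-! ### Domain closure and unique names -/

section Domain

open SOFormula

variable {σ : Sig.{v}} {K : Type u} {M : Type*} {I : Struct σ K M}

theorem models_and {F G : SOFormula σ K} : I.Models (.and F G) ↔ I.Models F ∧ I.Models G :=
  ⟨fun h => ⟨fun v X => (h v X).1, fun v X => (h v X).2⟩, fun h v X => ⟨h.1 v X, h.2 v X⟩⟩

variable [Nonempty M]

theorem models_DCA {C : Finset K} : I.Models (DCA σ C) ↔ ∀ m, ∃ c ∈ C, m = I.cst c := by
  have key : ∀ (v : ℕ → M) (X : Interp σ M),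
      (DCA σ C).Sat I v X ↔ ∀ m, ∃ c ∈ C, m = I.cst c := by
    intro v X
    simp only [DCA, Sat, sat_disj, exists_mem_map, Finset.mem_toList, Term.eval,
      Function.update_self]
  exact ⟨fun h => (key (fun _ => Classical.arbitrary M) I.rel).1 (h _ _),
    fun h v X => (key v X).2 h⟩

theorem models_UNA {C : Finset K} : I.Models (UNA σ C) ↔ Set.InjOn I.cst C := by
  have key : ∀ (v : ℕ → M) (X : Interp σ M), (UNA σ C).Sat I v X ↔ Set.InjOn I.cst C := by
    intro v X
    simp only [UNA, sat_conj, List.forall_mem_map, Finset.mem_toList, Finset.mem_offDiag,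
      SOFormula.neg, Sat, Term.eval, Prod.forall]
    refine ⟨fun h c hc d hd heq => ?_, fun h c d ⟨hc, hd, hne⟩ heq => hne (h hc hd heq)⟩
    by_contra hne
    exact h c d ⟨hc, hd, hne⟩ heq
  exact ⟨fun h => (key (fun _ => Classical.arbitrary M) I.rel).1 (h _ _),
    fun h v X => (key v X).2 h⟩

end Domain

/-! ### Safe programs and their active domain -/

section Safe

variable {σ : Sig.{v}} {K : Type u} {M M' : Type*}

/-- The image of an interpretation under a map of domains. -/
def Interp.map (e : M → M') (I : Interp σ M) : Interp σ M' := fun p => (fun t => e ∘ t) '' I p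

theorem Interp.mem_map {e : M → M'} (he : Function.Injective e) {I : Interp σ M} {p : σ.Pred}
    {t : Fin (σ.arity p) → M} : e ∘ t ∈ I.map e p ↔ t ∈ I p :=
  (he.comp_left).mem_set_image

theorem Interp.map_le_map {e : M → M'} (he : Function.Injective e) {I J : Interp σ M} :
    I.map e ≤ J.map e ↔ I ≤ J :=
  forall_congr' fun _ => Set.image_subset_image_iff he.comp_left

theorem Interp.map_injective {e : M → M'} (he : Function.Injective e) :
    Function.Injective (Interp.map e : Interp σ M → Interp σ M') := fun _ _ h =>
  le_antisymm ((Interp.map_le_map he).1 h.le) ((Interp.map_le_map he).1 h.ge)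

theorem Interp.exists_map_eq {e : M → M'} {J : Interp σ M'}
    (h : ∀ p, ∀ t ∈ J p, ∀ i, t i ∈ Set.range e) : ∃ I : Interp σ M, I.map e = J := by
  refine ⟨fun p => {s | e ∘ s ∈ J p}, funext fun p => subset_antisymm ?_ fun t ht => ?_⟩
  · rintro _ ⟨s, hs, rfl⟩
    exact hs
  · choose s hs using h p t ht
    obtain rfl : e ∘ s = t := funext hs
    exact ⟨s, ht, rfl⟩

theorem Term.eval_comp {V : Type*} {e : M → M'} {k : K → M} {k' : K → M'} {w : V → M}
    {t : Term K V} (h : ∀ c, t = .cst c → e (k c) = k' c) : t.eval k' (e ∘ w) = e (t.eval k w) := by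
  cases t with
  | var x => rfl
  | cst c => exact (h c rfl).symm

theorem Atom.holds_map {V : Type*} {e : M → M'} (he : Function.Injective e) {k : K → M}
    {k' : K → M'} {I : Interp σ M} {w : V → M} {a : Atom σ K V}
    (h : ∀ c ∈ a.consts, e (k c) = k' c) : a.Holds k' (I.map e) (e ∘ w) ↔ a.Holds k I w := by
  rw [Atom.Holds, Atom.Holds, ← Interp.mem_map he]
  have : (fun i => (a.args i).eval k' (e ∘ w)) = e ∘ fun i => (a.args i).eval k w :=
    funext fun i => Term.eval_comp fun c hc => h c ⟨i, hc⟩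
  rw [this]

theorem Builtin.holds_comp {V : Type*} {e : M → M'} (he : Function.Injective e) {k : K → M}
    {k' : K → M'} {w : V → M} {b : Builtin K V} (h : ∀ c ∈ b.consts, e (k c) = k' c) :
    b.Holds k' (e ∘ w) ↔ b.Holds k w := by
  cases b with
  | eq s t =>
    simp only [Builtin.Holds]
    rw [Term.eval_comp fun c hc => h c (.inl hc), Term.eval_comp fun c hc => h c (.inr hc),
      he.eq_iff]
  | ne s t =>
    simp only [Builtin.Holds]
    rw [Term.eval_comp fun c hc => h c (.inl hc), Term.eval_comp fun c hc => h c (.inr hc),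
      he.ne_iff]

/-- The variables of a safe rule with a true body take values in the extensions of predicates. -/
theorem Rule.Safe.mem_of_pos {r : Rule σ K} (hr : r.Safe) {k : K → M} {N : Interp σ M} {B : Set M}
    (hB : ∀ p, ∀ t ∈ N p, ∀ i, t i ∈ B) {w : Fin r.nvars → M} (hpos : ∀ a ∈ r.pos, a.Holds k N w)
    (x : Fin r.nvars) : w x ∈ B := by
  obtain ⟨a, ha, i, hi⟩ := hr x
  have := hB _ _ (hpos a ha) i
  rwa [hi] at this

theorem reductSat_map {e : M → M'} (he : Function.Injective e) {k : K → M} {k' : K → M'}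
    {P : Program σ K} (hsafe : ∀ r ∈ P, r.Safe)
    (hk : ∀ r ∈ P, ∀ c ∈ r.consts, e (k c) = k' c) {I N : Interp σ M} :
    ReductSat k' P (I.map e) (N.map e) ↔ ReductSat k P I N := by
  refine forall₂_congr fun r hr => ?_
  have hw : ∀ w : Fin r.nvars → M,
      ((∀ a ∈ r.neg, ¬ a.Holds k' (I.map e) (e ∘ w)) → (∀ b ∈ r.built, b.Holds k' (e ∘ w)) →
        (∀ a ∈ r.pos, a.Holds k' (N.map e) (e ∘ w)) → ∃ a ∈ r.head, a.Holds k' (N.map e) (e ∘ w)) ↔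
      ((∀ a ∈ r.neg, ¬ a.Holds k I w) → (∀ b ∈ r.built, b.Holds k w) →
        (∀ a ∈ r.pos, a.Holds k N w) → ∃ a ∈ r.head, a.Holds k N w) := by
    intro w
    refine imp_congr (forall₂_congr fun a ha => not_congr ?_) (imp_congr
      (forall₂_congr fun b hb => ?_) (imp_congr (forall₂_congr fun a ha => ?_)
        (exists_congr fun a => and_congr_right fun ha => ?_)))
    · exact Atom.holds_map he fun c hc => hk r hr c (.inr (.inr (.inl ⟨a, ha, hc⟩)))
    · exact Builtin.holds_comp he fun c hc => hk r hr c (.inr (.inr (.inr ⟨b, hb, hc⟩)))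
    · exact Atom.holds_map he fun c hc => hk r hr c (.inr (.inl ⟨a, ha, hc⟩))
    · exact Atom.holds_map he fun c hc => hk r hr c (.inl ⟨a, ha, hc⟩)
  refine ⟨fun h w => (hw w).1 (h _), fun h w' hneg hbuilt hpos => ?_⟩
  have hrange : ∀ x, w' x ∈ Set.range e := (hsafe r hr).mem_of_pos (N := N.map e)
    (by rintro p _ ⟨s, -, rfl⟩ i; exact ⟨s i, rfl⟩) hpos
  choose w hw' using hrange
  obtain rfl : e ∘ w = w' := funext hw'
  exact (hw w).2 (h w) hneg hbuilt hpos

/-- Stability of a safe program is not affected by additional domain elements. -/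
theorem stableOn_map {e : M → M'} (he : Function.Injective e) {k : K → M} {k' : K → M'}
    {l : Set σ.Pred} {P : Program σ K} (hsafe : ∀ r ∈ P, r.Safe)
    (hk : ∀ r ∈ P, ∀ c ∈ r.consts, e (k c) = k' c) {I : Interp σ M} :
    StableOn k' l P (I.map e) ↔ StableOn k l P I := by
  refine and_congr (reductSat_map he hsafe hk) ⟨fun h N hN hoff hred => ?_,
    fun h N' hN' hoff hred => ?_⟩
  · refine Interp.map_injective he (h _ ((Interp.map_le_map he).2 hN) (fun p hp => ?_)
      ((reductSat_map he hsafe hk).2 hred))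
    simp only [Interp.map, hoff p hp]
  · obtain ⟨N, rfl⟩ := Interp.exists_map_eq (e := e) (J := N') fun p t ht i => by
      obtain ⟨s, -, rfl⟩ := hN' p ht
      exact ⟨s i, rfl⟩
    rw [h N ((Interp.map_le_map he).1 hN') (fun p hp => ?_) ((reductSat_map he hsafe hk).1 hred)]
    exact he.comp_left.image_injective (hoff p hp)

/-- The stable models of a safe program contain only values of constants of the program. -/
theorem StableOn.mem_of_safe {k : K → M} {P : Program σ K} {I : Interp σ M}
    (hI : StableOn k Set.univ P I) (hsafe : ∀ r ∈ P, r.Safe) {B : Set M}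
    (hB : ∀ r ∈ P, ∀ c ∈ r.consts, k c ∈ B) : ∀ p, ∀ t ∈ I p, ∀ i, t i ∈ B := by
  let N : Interp σ M := fun p => {t ∈ I p | ∀ i, t i ∈ B}
  have hle : N ≤ I := fun p t ht => ht.1
  have hN : N = I := by
    refine hI.2 N hle (fun p hp => (hp trivial).elim) fun r hr w hneg hbuilt hpos => ?_
    obtain ⟨a, ha, h⟩ := hI.1 r hr w hneg hbuilt fun a ha => (hpos a ha).mono hle
    refine ⟨a, ha, h, fun i => ?_⟩
    change (a.args i).eval k w ∈ B
    cases hi : a.args i with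
    | var x => exact (hsafe r hr).mem_of_pos (N := N) (fun p t ht => ht.2) hpos x
    | cst c => exact hB r hr c (.inl ⟨a, ha, i, hi⟩)
  intro p t ht
  rw [← hN] at ht
  exact ht.2

end Safe

/-! ### Stratified normal programs -/

section Stratified

variable {σ : Sig.{v}} {U : Type u} {P : Program σ U}

/-- The intersection of all models of the reduct of `P` relative to `I`. -/
def leastModel (P : Program σ U) (I : Interp σ U) : Interp σ U :=
  fun p => {t | ∀ N : Interp σ U, ReductModel P I N → t ∈ N p}

theorem leastModel_le {I N : Interp σ U} (h : ReductModel P I N) : leastModel P I ≤ N :=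
  fun _ _ ht => ht N h

theorem reductModel_leastModel (hP : ∀ r ∈ P, ∃ h, r.head = [h]) (I : Interp σ U) :
    ReductModel P I (leastModel P I) := by
  intro r hr w hneg hbuilt hpos
  obtain ⟨h, hh⟩ := hP r hr
  refine ⟨h, by simp [hh], fun N hN => ?_⟩
  obtain ⟨a, ha, haN⟩ := hN r hr w hneg hbuilt fun a ha =>
    Atom.Holds.mono (leastModel_le hN) (hpos a ha)
  rw [hh, List.mem_singleton] at ha
  exact ha ▸ haN

theorem stableModel_iff_leastModel_eq (hP : ∀ r ∈ P, ∃ h, r.head = [h]) {I : Interp σ U} :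
    StableModel P I ↔ leastModel P I = I := by
  refine ⟨fun h => h.2 _ (leastModel_le h.1) (reductModel_leastModel hP I), fun h => ⟨?_, ?_⟩⟩
  · have := reductModel_leastModel hP I
    rwa [h] at this
  · exact fun N hN hred => le_antisymm hN (h.ge.trans (leastModel_le hred))

/-- The levels up to `n` of the least model of the reduct depend only on the levels below `n` of the
interpretation that is used to evaluate negation. -/
theorem leastModel_congr (hP : ∀ r ∈ P, ∃ h, r.head = [h]) {lv : σ.Pred → ℕ}
    (hlv : ∀ r ∈ P, ∀ h ∈ r.head, (∀ b ∈ r.pos, lv b.pred ≤ lv h.pred) ∧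
      ∀ b ∈ r.neg, lv b.pred < lv h.pred) {n : ℕ} {I J : Interp σ U}
    (hIJ : ∀ p, lv p < n → I p = J p) (p : σ.Pred) (hp : lv p < n + 1) :
    leastModel P I p = leastModel P J p := by
  -- Filling up the levels above `n` turns the least model relative to `J` into a model relative
  -- to `I`.
  have aux : ∀ {I J : Interp σ U}, (∀ p, lv p < n → I p = J p) → ∀ p, lv p < n + 1 →
      leastModel P I p ⊆ leastModel P J p := by
    intro I J hIJ p hp t ht
    let N : Interp σ U := fun q => {t | lv q < n + 1 → t ∈ leastModel P J q}
    refine ht N (fun r hr w hneg hbuilt hpos => ?_) hp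
    obtain ⟨h, hh⟩ := hP r hr
    refine ⟨h, by simp [hh], fun hn => ?_⟩
    have hl := hlv r hr h (by simp [hh])
    obtain ⟨a, ha, haN⟩ := reductModel_leastModel hP J r hr w
      (fun a ha hJ => hneg a ha ((Atom.holds_congr (hIJ _ (by have := hl.2 a ha; omega))).2 hJ))
      hbuilt (fun a ha => hpos a ha (by have := hl.1 a ha; omega))
    rw [hh, List.mem_singleton] at ha
    exact ha ▸ haN
  exact subset_antisymm (aux hIJ p hp) (aux (fun p hp => (hIJ p hp).symm) p hp)

/-- A stratified normal program has exactly one stable model, the fixed point that is reached by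
iterating `leastModel` along the levels. -/
theorem existsUnique_stableModel [Finite σ.Pred] (hP : ∀ r ∈ P, ∃ h, r.head = [h])
    (hstrat : Stratified P) : ∃! I : Interp σ U, StableModel P I := by
  obtain ⟨lv, hlv⟩ := hstrat
  have hlv' := fun r hr h hh => (hlv r hr h hh).2
  simp only [stableModel_iff_leastModel_eq hP]
  have hiter : ∀ (n : ℕ) (I J : Interp σ U) (p : σ.Pred), lv p < n →
      (leastModel P)^[n] I p = (leastModel P)^[n] J p := by
    intro n
    induction n with
    | zero => exact fun _ _ _ h => (Nat.not_lt_zero _ h).elim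
    | succ n ih =>
      intro I J p hp
      rw [Function.iterate_succ_apply', Function.iterate_succ_apply']
      exact leastModel_congr hP hlv' (ih I J) p hp
  obtain ⟨n, hn⟩ : ∃ n, ∀ p, lv p < n := by
    obtain ⟨m, hm⟩ := (Set.finite_range lv).bddAbove
    exact ⟨m + 1, fun p => Nat.lt_succ_of_le (hm ⟨p, rfl⟩)⟩
  have hconst : ∀ I J : Interp σ U, (leastModel P)^[n] I = (leastModel P)^[n] J :=
    fun I J => funext fun p => hiter n I J p (hn p)
  refine ⟨(leastModel P)^[n] ⊥, ?_, fun J hJ => ?_⟩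
  · exact (Function.iterate_succ_apply' _ _ _).symm.trans
      ((Function.iterate_succ_apply _ _ _).trans (hconst _ _))
  · rw [← hconst J, Function.iterate_fixed hJ]

end Stratified

/-! ### Repairs as stable models of the repair program -/

section Finiteness

variable {S : Sig.{v}} {U : Type u}

theorem Atom.finite_consts {V : Type*} (a : Atom S U V) : a.consts.Finite := by
  have : a.consts = ⋃ i, {c | a.args i = .cst c} := by
    ext c
    simp [Atom.consts]
  rw [this]
  exact Set.finite_iUnion fun i => Set.Subsingleton.finite fun c hc d hd =>
    Term.cst.inj ((Eq.symm hc).trans hd)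

theorem UIC.finite_post_consts (κ : UIC S U) : {c | ∃ a ∈ κ.post, c ∈ a.consts}.Finite :=
  (κ.post.finite_toSet.biUnion fun a _ => a.finite_consts).subset fun _ ⟨_, ha, hc⟩ =>
    Set.mem_biUnion ha hc

theorem Instance.finite_adom [Finite S.Pred] (D : Instance S U) : D.adom.Finite :=
  (Set.finite_iUnion fun p => ((D p).finite_toSet.biUnion fun t _ => Set.finite_range t)).subset
    fun _ ⟨p, _, ht, i, hi⟩ => Set.mem_iUnion.2 ⟨p, Set.mem_biUnion ht ⟨i, hi⟩⟩

theorem Instance.exists_ext_eq {R : Interp S U} (hR : ∀ p, (R p).Finite) :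
    ∃ D : Instance S U, D.ext = R :=
  ⟨fun p => (hR p).toFinset, funext fun p => (hR p).coe_toFinset⟩

end Finiteness

section Repair

variable {S A : Sig.{v}} {U : Type u}

/-- An interpretation of the combined program, assembled from the extensions `P`, `P_t`, `P_f`,
`P_⋆`, `P_⋆⋆` and those of the intensional query predicates. -/
def Interp.combine (d t f s r : Interp S U) (q : Interp A U) : Interp (cqaSig S A) U
  | .db p => d p
  | .tr p => t p
  | .fa p => f p
  | .st p => s p
  | .ss p => r p
  | .idb a => q a

/-- The repair rules of the constraints, for all partitions at once: `d`, `s`, `t`, `f` are the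
extensions of `P`, `P_⋆`, `P_t`, `P_f`. -/
def RepairRules (IC : List (UIC S U)) (d s t f : Interp S U) : Prop :=
  ∀ κ ∈ IC, ∀ w : Fin κ.nvars → U, (∀ b ∈ κ.phi, ¬ b.Holds id w) →
    (∀ a ∈ κ.pre, a.Holds id s w) → (∀ a ∈ κ.post, a.Holds id f w ∨ ¬ a.Holds id d w) →
    (∃ a ∈ κ.pre, a.Holds id f w) ∨ ∃ a ∈ κ.post, a.Holds id t w

theorem Builtin.holds_compl {K V M : Type*} {k : K → M} {w : V → M} {b : Builtin K V} :
    b.compl.Holds k w ↔ ¬ b.Holds k w := by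
  cases b <;> simp [Builtin.compl, Builtin.Holds]

theorem reductSat_repairRules {IC : List (UIC S U)} {I N : Interp (cqaSig S A) U} :
    ReductSat id (IC.flatMap fun κ => Finset.univ.toList.map (κ.repairRule A)) I N ↔
      RepairRules IC (fun p => I (.db p)) (fun p => N (.st p)) (fun p => N (.tr p))
        fun p => N (.fa p) := by
  classical
  constructor
  · intro h κ hκ w hphi hpre hpost
    let J : Finset (Fin κ.post.length) :=
      Finset.univ.filter fun j => (κ.post.get j).Holds id (fun p => N (CQAPred.fa p)) w
    have hJ : κ.repairRule A J ∈
        IC.flatMap fun κ => Finset.univ.toList.map (κ.repairRule A) :=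
      List.mem_flatMap.2 ⟨κ, hκ, List.mem_map_of_mem (Finset.mem_toList.2 (Finset.mem_univ J))⟩
    have hhead : ∃ a ∈ (κ.repairRule A J).head, a.Holds id N w := by
      refine h _ hJ w (fun a ha => ?_) (fun b hb => ?_) fun a ha => ?_
      · obtain ⟨j, hj, rfl⟩ := List.mem_map.1 ha
        rw [Finset.mem_toList] at hj
        exact (hpost _ (List.get_mem _ j)).resolve_left fun hf =>
          (Finset.mem_sdiff.1 hj).2 (Finset.mem_filter.2 ⟨Finset.mem_univ j, hf⟩)
      · obtain ⟨b', hb', rfl⟩ := List.mem_map.1 hb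
        exact Builtin.holds_compl.2 (hphi b' hb')
      · rcases List.mem_append.1 ha with ha | ha
        · obtain ⟨a', ha', rfl⟩ := List.mem_map.1 ha
          exact hpre a' ha'
        · obtain ⟨j, hj, rfl⟩ := List.mem_map.1 ha
          exact (Finset.mem_filter.1 (Finset.mem_toList.1 hj)).2
    obtain ⟨a, ha, haN⟩ := hhead
    rcases List.mem_append.1 ha with ha | ha
    · obtain ⟨a', ha', rfl⟩ := List.mem_map.1 ha
      exact .inl ⟨a', ha', haN⟩
    · obtain ⟨a', ha', rfl⟩ := List.mem_map.1 ha
      exact .inr ⟨a', ha', haN⟩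
  · intro h r hr w hneg hbuilt hpos
    simp only [List.mem_flatMap, List.mem_map, Finset.mem_toList, Finset.mem_univ, true_and] at hr
    obtain ⟨κ, hκ, J, rfl⟩ := hr
    have hpost : ∀ a ∈ κ.post, a.Holds id (fun p => N (CQAPred.fa p)) w ∨
        ¬ a.Holds id (fun p => I (CQAPred.db p)) w := by
      intro a ha
      obtain ⟨j, rfl⟩ := List.get_of_mem ha
      by_cases hj : j ∈ J
      · exact .inl (hpos _ (List.mem_append_right _
          (List.mem_map_of_mem (f := fun j => (κ.post.get j).fa) (Finset.mem_toList.2 hj))))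
      · exact .inr (hneg _ (List.mem_map_of_mem (f := fun j => (κ.post.get j).db)
          (Finset.mem_toList.2 (Finset.mem_sdiff.2 ⟨Finset.mem_univ j, hj⟩))))
    rcases h κ hκ w (fun b hb => Builtin.holds_compl.1 (hbuilt _ (List.mem_map_of_mem hb)))
      (fun a ha => hpos _ (List.mem_append_left _ (List.mem_map_of_mem ha)))
      hpost with ⟨a, ha, haN⟩ | ⟨a, ha, haN⟩
    · exact ⟨a.fa, List.mem_append_left _ (List.mem_map_of_mem ha), haN⟩
    · exact ⟨a.tr, List.mem_append_right _ (List.mem_map_of_mem ha), haN⟩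

theorem reductSat_annotationRules [Fintype S.Pred] {I N : Interp (cqaSig S A) U} :
    ReductSat id (Finset.univ.toList.flatMap (annotationRules A U)) I N ↔
      ∀ p, (N (.db p) ⊆ N (.st p) ∧ N (.tr p) ⊆ N (.st p) ∧ N (.st p) \ I (.fa p) ⊆ N (.ss p)) ∧
        ∀ x ∈ N (.tr p), x ∉ N (.fa p) := by
  simp only [ReductSat, List.mem_flatMap, Finset.mem_toList, Finset.mem_univ, true_and,
    annotationRules, List.mem_cons, List.not_mem_nil, or_false, forall_exists_index, or_imp,
    forall_and, forall_eq_apply_imp_iff, forall_eq, false_imp_iff, imp_true_iff, true_imp_iff,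
    exists_eq_left, false_and, exists_false, and_imp, and_assoc]
  exact and_congr .rfl (and_congr .rfl (and_congr
    (forall₂_congr fun p w => ⟨fun h hx => h hx.2 hx.1, fun h hf hs => h ⟨hs, hf⟩⟩) .rfl))

/-- Truth of the constraints in a possibly infinite Herbrand structure. -/
def Interp.SatisfiesAll (R : Interp S U) (IC : List (UIC S U)) : Prop :=
  ∀ κ ∈ IC, ∀ w : Fin κ.nvars → U, (∀ a ∈ κ.pre, a.Holds id R w) →
    (∃ a ∈ κ.post, a.Holds id R w) ∨ ∃ b ∈ κ.phi, b.Holds id w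

/-- Inserting `t` and deleting `f` repairs all violations if the repair rules are true. -/
theorem RepairRules.satisfiesAll {IC : List (UIC S U)} {d s t f : Interp S U}
    (h : RepairRules IC d s t f) (hds : d ≤ s) (hts : t ≤ s) (hdisj : ∀ p, ∀ x ∈ t p, x ∉ f p) :
    Interp.SatisfiesAll (fun p => (d p ∪ t p) \ f p) IC := by
  intro κ hκ w hpre
  by_contra! hcon
  obtain ⟨hpost, hphi⟩ := hcon
  have hbody : ∀ a ∈ κ.post, a.Holds id f w ∨ ¬ a.Holds id d w := by
    intro a ha
    by_contra! hfd
    exact hpost a ha ⟨.inl hfd.2, hfd.1⟩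
  rcases h κ hκ w hphi (fun a ha => (hpre a ha).1.elim (fun h => hds _ h) fun h => hts _ h) hbody
    with ⟨a, ha, haf⟩ | ⟨a, ha, hat⟩
  · exact (hpre a ha).2 haf
  · exact hpost a ha ⟨.inr hat, hdisj _ _ hat⟩

/-- The changes that lead to a consistent structure make the repair rules true. -/
theorem Interp.SatisfiesAll.repairRules {IC : List (UIC S U)} {d R : Interp S U}
    (h : R.SatisfiesAll IC) :
    RepairRules IC d (fun p => d p ∪ R p) (fun p => R p \ d p) fun p => d p \ R p := by
  intro κ hκ w hphi hpre hpost
  by_cases hR : ∀ a ∈ κ.pre, a.Holds id R w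
  · rcases h κ hκ w hR with ⟨a, ha, haR⟩ | ⟨b, hb, hbw⟩
    · refine .inr ⟨a, ha, haR, fun had => ?_⟩
      exact (hpost a ha).elim (fun h => h.2 haR) fun h => h had
    · exact (hphi b hb hbw).elim
  · push Not at hR
    obtain ⟨a, ha, haR⟩ := hR
    exact .inl ⟨a, ha, (hpre a ha).resolve_right haR, haR⟩

/-- Comparing instances with `D` by the tuples that are inserted and deleted. -/
theorem delta_le_iff {D D₁ D₂ : Instance S U} : delta D D₁ ≤ delta D D₂ ↔
    ∀ p, D₁.ext p \ D.ext p ⊆ D₂.ext p \ D.ext p ∧ D.ext p \ D₁.ext p ⊆ D.ext p \ D₂.ext p := by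
  refine forall_congr' fun p => ⟨fun h => ⟨fun x hx => ?_, fun x hx => ?_⟩, fun h x hx => ?_⟩
  · exact (h (.inr hx)).resolve_left fun h' => hx.2 h'.1
  · exact (h (.inl hx)).resolve_right fun h' => h'.2 hx.1
  · exact hx.elim (fun hx => .inl (h.2 hx)) fun hx => .inr (h.1 hx)

variable [Fintype S.Pred]

theorem mem_repairPreds {q : CQAPred S A} :
    q ∈ repairPreds S A ↔ (∀ p, q ≠ .db p) ∧ ∀ a, q ≠ .idb a := by
  have h : q ∈ Finset.univ.toList.flatMap (β := CQAPred S A)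
      (fun p : S.Pred => [.tr p, .fa p, .st p, .ss p]) ↔
        (∀ p, q ≠ .db p) ∧ ∀ a, q ≠ .idb a := by
    cases q <;> simp
  exact h

theorem db_notMem_repairPreds (p : S.Pred) :
    CQAPred.db p ∉ repairPreds S A :=
  fun h => (mem_repairPreds.1 h).1 p rfl

theorem idb_notMem_repairPreds (a : A.Pred) :
    CQAPred.idb a ∉ repairPreds S A :=
  fun h => (mem_repairPreds.1 h).2 a rfl

theorem reductSat_repairProgram {IC : List (UIC S U)} {I N : Interp (cqaSig S A) U} :
    ReductSat id (repairProgram A IC) I N ↔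
      RepairRules IC (fun p => I (.db p)) (fun p => N (.st p)) (fun p => N (.tr p))
          (fun p => N (.fa p)) ∧
        ∀ p, (N (.db p) ⊆ N (.st p) ∧ N (.tr p) ⊆ N (.st p) ∧
          N (.st p) \ I (.fa p) ⊆ N (.ss p)) ∧ ∀ x ∈ N (.tr p), x ∉ N (.fa p) :=
  reductSat_append.trans (and_congr reductSat_repairRules reductSat_annotationRules)

/-- The constants that can occur in a repair: a tuple is inserted only as an instance of an atom
`Qⱼ(ȳⱼ)` whose variables take values in existing tuples. -/
def relevantConsts (D : Instance S U) (IC : List (UIC S U)) : Set U :=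
  D.adom ∪ ⋃ κ ∈ IC, {c | ∃ a ∈ κ.post, c ∈ a.consts}

theorem finite_relevantConsts (D : Instance S U) (IC : List (UIC S U)) :
    (relevantConsts D IC).Finite :=
  D.finite_adom.union (IC.finite_toSet.biUnion fun κ _ => κ.finite_post_consts)

/-- In a stable model of the repair program, `P_t` contains only new tuples, with constants from
`D` and the constraints, `P_f` contains only tuples of `D`, and these sets determine the other
annotations: restricting them accordingly yields a model of the reduct. -/
theorem StableOn.annotations_eq {IC : List (UIC S U)} (hIC : ∀ κ ∈ IC, κ.Safe) {D : Instance S U}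
    {I : Interp (cqaSig S A) U} (hdb : ∀ p, I (.db p) = D.ext p)
    (hI : StableOn id {q | q ∈ repairPreds S A} (repairProgram A IC) I) :
    (fun p => I (.tr p)) = (fun p => {x ∈ I (.tr p) | x ∉ D.ext p ∧
        ∀ i, x i ∈ relevantConsts D IC}) ∧
      (fun p => I (.fa p)) = (fun p => D.ext p ∩ I (.fa p)) ∧
      (fun p => I (.st p)) = (fun p => D.ext p ∪ I (.tr p)) ∧
      (fun p => I (.ss p)) = (fun p => (D.ext p ∪ I (.tr p)) \ I (.fa p)) := by
  obtain ⟨hred, hmin⟩ := hI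
  obtain ⟨hrules, hann⟩ := reductSat_repairProgram.1 hred
  let t : Interp S U := fun p => {x ∈ I (.tr p) | x ∉ D.ext p ∧ ∀ i, x i ∈ relevantConsts D IC}
  let f : Interp S U := fun p => D.ext p ∩ I (.fa p)
  let s : Interp S U := fun p => D.ext p ∪ t p
  let N : Interp (cqaSig S A) U := Interp.combine D.ext t f s (fun p => s p \ I (.fa p))
    fun a => I (.idb a)
  have hts : ∀ p, t p ⊆ I (.tr p) := fun p x hx => hx.1
  have hds : ∀ p, D.ext p ⊆ I (.st p) := fun p => hdb p ▸ (hann p).1.1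
  have hs : ∀ p, s p ⊆ I (.st p) := fun p =>
    Set.union_subset (hds p) ((hts p).trans (hann p).1.2.1)
  have hN : N = I := by
    refine hmin N ?_ ?_ (reductSat_repairProgram.2 ⟨?_, fun p => ⟨⟨?_, ?_, ?_⟩, ?_⟩⟩)
    · rintro (p | p | p | p | p | a)
      · exact (hdb p).ge
      · exact hts p
      · exact Set.inter_subset_right
      · exact hs p
      · exact (Set.sdiff_subset_sdiff_left (hs p)).trans (hann p).1.2.2
      · exact subset_rfl
    · intro q hq
      cases q with
      | db p => exact (hdb p).symm
      | idb a => rfl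
      | _ => exact (hq (mem_repairPreds.2 (by simp))).elim
    · intro κ hκ w hphi hpre hpost
      -- The variables take relevant values since the constraint is safe.
      have hw : ∀ x, w x ∈ relevantConsts D IC := by
        intro x
        obtain ⟨a, ha, i, hi⟩ := hIC κ hκ x
        have hval : ∀ y ∈ s a.pred, ∀ i, y i ∈ relevantConsts D IC := by
          rintro y (hy | hy) i
          · exact .inl ⟨_, y, hy, i, rfl⟩
          · exact hy.2.2 i
        have := hval _ (hpre a ha) i
        rwa [hi] at this
      have hpost' : ∀ a ∈ κ.post, a.Holds id f w ∨ ¬ a.Holds id D.ext w := fun a ha =>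
        (hpost a ha).imp_right fun h h' => h ((Atom.holds_congr (σ := S) (hdb a.pred)).2 h')
      rcases hrules κ hκ w hphi (fun a ha => hs _ (hpre a ha))
        (fun a ha => (hpost a ha).imp_left fun h => h.2) with ⟨a, ha, haf⟩ | ⟨a, ha, hat⟩
      · refine .inl ⟨a, ha, ?_, haf⟩
        exact (hpre a ha).resolve_right fun h => (hann _).2 _ (hts _ h) haf
      · refine .inr ⟨a, ha, hat, fun had => ?_, fun i => ?_⟩
        · exact (hpost' a ha).elim (fun h => (hann _).2 _ hat h.2) fun h => h had
        · change (a.args i).eval id w ∈ relevantConsts D IC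
          cases hi : a.args i with
          | var x => exact hw x
          | cst c => exact .inr (Set.mem_biUnion hκ ⟨a, ha, i, hi⟩)
    · exact Set.subset_union_left
    · exact Set.subset_union_right
    · exact subset_rfl
    · exact fun x hx hxf => (hann p).2 x (hts p hx) hxf.2
  have ht : ∀ p, t p = I (.tr p) := fun p => congrFun hN (.tr p)
  refine ⟨funext fun p => (ht p).symm, funext fun p => (congrFun hN (.fa p)).symm,
    funext fun p => ?_, funext fun p => ?_⟩
  · rw [← ht]
    exact (congrFun hN (.st p)).symm
  · rw [← ht]
    exact (congrFun hN (.ss p)).symm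

/-- The stable models of the repair program over `D` are given by the repairs of `D`. -/
theorem stableOn_repairProgram_iff {IC : List (UIC S U)} (hIC : ∀ κ ∈ IC, κ.Safe)
    {D : Instance S U} {I : Interp (cqaSig S A) U} (hdb : ∀ p, I (.db p) = D.ext p) :
    StableOn id {q | q ∈ repairPreds S A} (repairProgram A IC) I ↔
      ∃ D' ∈ Repairs D IC, I = Interp.combine D.ext (fun p => D'.ext p \ D.ext p)
        (fun p => D.ext p \ D'.ext p) (fun p => D.ext p ∪ D'.ext p) D'.ext fun a => I (.idb a) := by
  constructor
  · intro hI
    obtain ⟨ht, hf, hs, hr⟩ := hI.annotations_eq hIC hdb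
    obtain ⟨hred, hmin⟩ := hI
    obtain ⟨hrules, hann⟩ := reductSat_repairProgram.1 hred
    have htd : ∀ p, ∀ x ∈ I (.tr p), x ∉ D.ext p := fun p x hx =>
      ((congrFun ht p).le hx).2.1
    have hfd : ∀ p, ∀ x ∈ I (.fa p), x ∈ D.ext p := fun p x hx => ((congrFun hf p).le hx).1
    obtain ⟨D', hD'⟩ := Instance.exists_ext_eq (S := S) (R := fun p => I (.ss p)) fun p => by
      have hfin : {x : Fin (S.arity p) → U | ∀ i, x i ∈ relevantConsts D IC}.Finite :=
        Set.Finite.pi' fun _ => finite_relevantConsts D IC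
      refine ((D p).finite_toSet.union hfin).subset fun x hx => ?_
      exact ((congrFun hr p).le hx).1.imp_right fun h => ((congrFun ht p).le h).2.2
    have hD : ∀ p, D'.ext p = (D.ext p ∪ I (.tr p)) \ I (.fa p) := fun p =>
      (congrFun hD' p).trans (congrFun hr p)
    have hIt : ∀ p, I (.tr p) = D'.ext p \ D.ext p := by
      intro p
      rw [hD]
      exact Set.ext fun x => ⟨fun hx => ⟨⟨.inr hx, (hann p).2 x hx⟩, htd p x hx⟩,
        fun hx => hx.1.1.resolve_left hx.2⟩
    have hIf : ∀ p, I (.fa p) = D.ext p \ D'.ext p := by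
      intro p
      rw [hD]
      exact Set.ext fun x => ⟨fun hx => ⟨hfd p x hx, fun h => h.2 hx⟩,
        fun hx => by_contra fun h => hx.2 ⟨.inl hx.1, h⟩⟩
    have hIs : ∀ p, I (.st p) = D.ext p ∪ D'.ext p := by
      intro p
      rw [congrFun hs p, hIt p, Set.union_sdiff_self]
    have hsat : D'.ext.SatisfiesAll IC := by
      have hrules' : RepairRules IC D.ext (fun p => I (.st p)) (fun p => I (.tr p))
          fun p => I (.fa p) := by
        have := hrules
        rwa [show (fun p => I (.db p)) = D.ext from funext hdb] at this
      have := hrules'.satisfiesAll (fun p => hdb p ▸ (hann p).1.1) (fun p => (hann p).1.2.1)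
        fun p => (hann p).2
      rwa [show D'.ext = _ from funext hD]
    refine ⟨D', ⟨hsat, fun D'' hD'' hle => ?_⟩, funext ?_⟩
    · rw [delta_le_iff] at hle
      let N : Interp (cqaSig S A) U := Interp.combine D.ext (fun p => D''.ext p \ D.ext p)
        (fun p => D.ext p \ D''.ext p) (fun p => D.ext p ∪ D''.ext p)
        (fun p => (D.ext p ∪ D''.ext p) \ I (.fa p)) fun a => I (.idb a)
      have hst : ∀ p, D.ext p ∪ D''.ext p ⊆ I (.st p) := by
        intro p
        rw [hIs, ← Set.union_sdiff_self, ← Set.union_sdiff_self (t := D'.ext p)]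
        exact Set.union_subset_union_right _ (hle p).1
      have hN : N = I := by
        refine hmin N ?_ ?_ (reductSat_repairProgram.2 ⟨?_, fun p => ⟨⟨?_, ?_, ?_⟩, ?_⟩⟩)
        · rintro (p | p | p | p | p | a)
          · exact (hdb p).ge
          · exact (hle p).1.trans (hIt p).ge
          · exact (hle p).2.trans (hIf p).ge
          · exact hst p
          · exact (Set.sdiff_subset_sdiff_left (hst p)).trans (hann p).1.2.2
          · exact subset_rfl
        · intro q hq
          cases q with
          | db p => exact (hdb p).symm
          | idb a => rfl
          | _ => exact (hq (mem_repairPreds.2 (by simp))).elim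
        · rw [show (fun p => I (.db p)) = D.ext from funext hdb]
          exact Interp.SatisfiesAll.repairRules (R := D''.ext) hD''
        · exact Set.subset_union_left
        · exact Set.sdiff_subset.trans Set.subset_union_right
        · exact subset_rfl
        · exact fun x hx hxf => hx.2 hxf.1
      refine le_antisymm (delta_le_iff.2 hle) (delta_le_iff.2 fun p => ⟨?_, ?_⟩)
      · rw [← hIt]
        exact (congrFun hN (.tr p)).ge
      · rw [← hIf]
        exact (congrFun hN (.fa p)).ge
    · rintro (p | p | p | p | p | a)
      · exact hdb p
      · exact hIt p
      · exact hIf p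
      · exact hIs p
      · exact (congrFun hD' p).symm
      · rfl
  · rintro ⟨D', ⟨hsat, hmin⟩, hI⟩
    have hIt : ∀ p, I (.tr p) = D'.ext p \ D.ext p := fun p => congrFun hI (.tr p)
    have hIf : ∀ p, I (.fa p) = D.ext p \ D'.ext p := fun p => congrFun hI (.fa p)
    have hIs : ∀ p, I (.st p) = D.ext p ∪ D'.ext p := fun p => congrFun hI (.st p)
    have hIr : ∀ p, I (.ss p) = D'.ext p := fun p => congrFun hI (.ss p)
    have hsf : ∀ p, I (.st p) \ I (.fa p) = D'.ext p := by
      intro p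
      rw [hIs, hIf]
      refine Set.ext fun x => ⟨fun hx => ?_, fun hx => ⟨.inr hx, fun h => h.2 hx⟩⟩
      exact by_contra fun h => hx.2 ⟨hx.1.resolve_right h, h⟩
    refine ⟨reductSat_repairProgram.2 ⟨?_, fun p => ⟨⟨?_, ?_, ?_⟩, ?_⟩⟩,
      fun N hN hoff hred => ?_⟩
    · rw [show (fun p => I (.db p)) = D.ext from funext hdb, show (fun p => I (.st p)) = _ from
        funext hIs, show (fun p => I (.tr p)) = _ from funext hIt,
        show (fun p => I (.fa p)) = _ from funext hIf]
      exact Interp.SatisfiesAll.repairRules (R := D'.ext) hsat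
    · rw [hdb, hIs]
      exact Set.subset_union_left
    · rw [hIt, hIs]
      exact Set.sdiff_subset.trans Set.subset_union_right
    · exact (hsf p).le.trans (hIr p).ge
    · rw [hIt, hIf]
      exact fun x hx hxf => hx.2 hxf.1
    · obtain ⟨hrules, hann⟩ := reductSat_repairProgram.1 hred
      rw [show (fun p => I (.db p)) = D.ext from funext hdb] at hrules
      have hNdb : ∀ p, N (.db p) = D.ext p := fun p =>
        (hoff (.db p) (db_notMem_repairPreds p)).trans (hdb p)
      have hNt : ∀ p, N (.tr p) ⊆ D'.ext p \ D.ext p := fun p => (hN (.tr p)).trans (hIt p).le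
      have hNf : ∀ p, N (.fa p) ⊆ D.ext p \ D'.ext p := fun p => (hN (.fa p)).trans (hIf p).le
      -- The changes in `N` lead to an instance `D''` that is at least as close to `D` as `D'`.
      obtain ⟨D'', hD''⟩ := Instance.exists_ext_eq (S := S)
        (R := fun p => (D.ext p ∪ N (.tr p)) \ N (.fa p)) fun p =>
          (((D p).finite_toSet.union ((D' p).finite_toSet.subset
            ((hNt p).trans Set.sdiff_subset))).subset Set.sdiff_subset)
      have hmem : ∀ p x, x ∈ D''.ext p ↔ (x ∈ D.ext p ∨ x ∈ N (.tr p)) ∧ x ∉ N (.fa p) := by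
        intro p x
        rw [hD'']
        rfl
      have hsat'' : D''.ext.SatisfiesAll IC := by
        rw [hD'']
        exact hrules.satisfiesAll (fun p => hNdb p ▸ (hann p).1.1) (fun p => (hann p).1.2.1)
          fun p => (hann p).2
      have heq := hmin D'' hsat'' (delta_le_iff.2 fun p => ⟨fun x hx => ?_, fun x hx => ?_⟩)
      · have hle := delta_le_iff.1 heq.ge
        have ht : ∀ p, I (.tr p) ⊆ N (.tr p) := by
          intro p x hx
          rw [hIt] at hx
          have := (hle p).1 hx
          exact ((hmem p x).1 this.1).1.resolve_left this.2
        have hf : ∀ p, I (.fa p) ⊆ N (.fa p) := by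
          intro p x hx
          rw [hIf] at hx
          have := (hle p).2 hx
          exact by_contra fun h => this.2 ((hmem p x).2 ⟨.inl this.1, h⟩)
        have hs : ∀ p, I (.st p) ⊆ N (.st p) := by
          intro p
          rw [hIs, ← Set.union_sdiff_self, ← hIt]
          exact Set.union_subset (hNdb p ▸ (hann p).1.1) ((ht p).trans (hann p).1.2.1)
        refine le_antisymm hN ?_
        rintro (p | p | p | p | p | a)
        · exact (hoff (.db p) (db_notMem_repairPreds p)).ge
        · exact ht p
        · exact hf p
        · exact hs p
        · refine (hIr p).le.trans ((hsf p).ge.trans ?_)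
          exact (Set.sdiff_subset_sdiff_left (hs p)).trans (hann p).1.2.2
        · exact (hoff (.idb a) (idb_notMem_repairPreds a)).ge
      · exact hNt p (((hmem p x).1 hx.1).1.resolve_left hx.2)
      · exact hNf p (by_contra fun h => hx.2 ((hmem p x).2 ⟨.inl hx.1, h⟩))

end Repair

/-! ### Query programs -/

section QueryProgram

variable {S A : Sig.{v}} {U : Type u}

/-- An interpretation of the combined program, read as an interpretation of the query program: the
extension of `P` is that of `P_⋆⋆`. -/
def Interp.unstar {M : Type*} (I : Interp (cqaSig S A) M) : Interp (S.sum A) M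
  | .inl p => I (.ss p)
  | .inr a => I (.idb a)

theorem Atom.holds_starred {V M : Type*} {k : U → M} {I : Interp (cqaSig S A) M} {w : V → M}
    (a : Atom (S.sum A) U V) : a.starred.Holds k I w ↔ a.Holds k I.unstar w := by
  rcases a with ⟨p | a, ts⟩ <;> rfl

theorem Atom.consts_starred {V : Type*} (a : Atom (S.sum A) U V) : a.starred.consts = a.consts := by
  rcases a with ⟨p | a, ts⟩ <;> rfl

theorem reductSat_queryProgram {M : Type*} {k : U → M} {P : Program (S.sum A) U}
    {I N : Interp (cqaSig S A) M} :
    ReductSat k (queryProgram P) I N ↔ ReductSat k P I.unstar N.unstar := by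
  rw [queryProgram, ReductSat, List.forall_mem_map]
  refine forall₂_congr fun r _ => forall_congr' fun w => ?_
  exact imp_congr (List.forall_mem_map.trans (forall₂_congr fun a _ => not_congr a.holds_starred))
    (imp_congr .rfl (imp_congr
      (List.forall_mem_map.trans (forall₂_congr fun a _ => a.holds_starred))
      (exists_mem_map.trans (exists_congr fun a => and_congr_right fun _ => a.holds_starred))))

variable [Fintype A.Pred]

theorem mem_queryPreds {q : CQAPred S A} : q ∈ queryPreds S A ↔ ∃ a, q = .idb a := by
  have h : q ∈ Finset.univ.toList.map (β := CQAPred S A) (fun a : A.Pred => .idb a) ↔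
      ∃ a, q = .idb a := by
    simp [eq_comm]
  exact h

theorem stableOn_queryProgram_iff {P : Program (S.sum A) U} {I : Interp (cqaSig S A) U} :
    StableOn id {q | q ∈ queryPreds S A} (queryProgram P) I ↔
      StableOn id (Set.range Sum.inr) P I.unstar := by
  refine and_congr reductSat_queryProgram ⟨fun h N hN hoff hred => ?_, fun h N hN hoff hred => ?_⟩
  · let N' : Interp (cqaSig S A) U := Interp.combine (fun p => I (.db p)) (fun p => I (.tr p))
      (fun p => I (.fa p)) (fun p => I (.st p)) (fun p => I (.ss p)) fun a => N (.inr a)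
    have hN' : N'.unstar = N := by
      funext q
      rcases q with p | a
      · exact (hoff (.inl p) (by rintro ⟨a, ⟨⟩⟩)).symm
      · rfl
    have heq : N' = I := by
      refine h N' ?_ ?_ (reductSat_queryProgram.2 (hN' ▸ hred))
      · rintro (p | p | p | p | p | a)
        case idb => exact hN (.inr a)
        all_goals exact subset_rfl
      · intro q hq
        cases q with
        | idb a => exact (hq (mem_queryPreds.2 ⟨a, rfl⟩)).elim
        | _ => rfl
    rw [← hN', heq]
  · have hss : ∀ p, N (.ss p) = I (.ss p) := fun p =>
      hoff (.ss p) fun hq => by obtain ⟨a, ⟨⟩⟩ := mem_queryPreds.1 hq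
    have heq : N.unstar = I.unstar := by
      refine h N.unstar ?_ ?_ (reductSat_queryProgram.1 hred)
      · rintro (p | a)
        · exact hN (.ss p)
        · exact hN (.idb a)
      · rintro (p | a) hq
        · exact hss p
        · exact (hq ⟨a, rfl⟩).elim
    funext q
    by_cases hq : q ∈ queryPreds S A
    · obtain ⟨a, rfl⟩ := mem_queryPreds.1 hq
      exact congrFun heq (.inr a)
    · exact hoff q hq

end QueryProgram

section Answers

variable {S A : Sig.{v}} [Fintype S.Pred] {U : Type u} {P : Program (S.sum A) U}

theorem stableModel_facts_append_iff (hP : IsQueryProgram P) {D : Instance S U}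
    {M : Interp (S.sum A) U} :
    StableModel (D.facts.map (Rule.map Atom.edb) ++ P) M ↔
      (∀ p, M (.inl p) = D.ext p) ∧ StableOn id (Set.range Sum.inr) P M := by
  have hl : (Set.univ : Set (S.sum A).Pred) = Set.range Sum.inl ∪ Set.range Sum.inr :=
    Set.range_inl_union_range_inr.symm
  have hfacts := stableOn_facts_edb (A := A) (D := D) (k := id) (I := M)
  rw [D.eval_id] at hfacts
  rw [stableModel_iff_stableOn, hl]
  refine (stableOn_append ?_ ?_ ?_).trans (and_congr_left' hfacts)
  · intro r hr a ha
    obtain ⟨p, t, -, rfl⟩ := mem_facts_map.1 hr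
    obtain rfl := List.mem_singleton.1 ha
    rintro ⟨_, ⟨⟩⟩
  · intro r hr a ha
    obtain ⟨h, hh, b, hb⟩ := hP.1 r hr
    rw [hh, List.mem_singleton] at ha
    rw [ha, hb]
    rintro ⟨_, ⟨⟩⟩
  · intro r hr a ha
    obtain ⟨p, t, -, rfl⟩ := mem_facts_map.1 hr
    exact (List.not_mem_nil ha).elim

theorem existsUnique_stableModel_facts_append [Finite A.Pred] (hP : IsQueryProgram P)
    (D : Instance S U) :
    ∃! M : Interp (S.sum A) U, StableModel (D.facts.map (Rule.map Atom.edb) ++ P) M := by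
  have : Finite (S.sum A).Pred := inferInstanceAs (Finite (S.Pred ⊕ A.Pred))
  refine existsUnique_stableModel (fun r hr => ?_) ?_
  · rcases List.mem_append.1 hr with hr | hr
    · obtain ⟨p, t, -, rfl⟩ := mem_facts_map.1 hr
      exact ⟨_, rfl⟩
    · obtain ⟨h, hh, -⟩ := hP.1 r hr
      exact ⟨h, hh⟩
  · obtain ⟨lv, hlv⟩ := hP.2.2
    refine ⟨lv, fun r hr => ?_⟩
    rcases List.mem_append.1 hr with hr | hr
    · obtain ⟨p, t, -, rfl⟩ := mem_facts_map.1 hr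
      intro h hh
      obtain rfl := List.mem_singleton.1 hh
      refine ⟨fun h' hh' => ?_, fun b hb => (List.not_mem_nil hb).elim,
        fun b hb => (List.not_mem_nil hb).elim⟩
      obtain rfl := List.mem_singleton.1 hh'
      rfl
    · exact hlv r hr

theorem Query.holds_iff_datalogAnswer {ans : A.Pred} {Q : Query S A ans U}
    (hQ : Q.RepresentedBy P) {D : Instance S U} {b : Fin (A.arity ans) → U} :
    Q.Holds D b ↔ DatalogAnswer P ans D b := by
  cases Q with
  | fo φ => exact hQ D b
  | datalog P' =>
    obtain rfl : P' = P := hQ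
    rfl

variable [Fintype A.Pred]

/-- The query program has a stable model over every instance. -/
theorem exists_stableOn_queryProgram (hP : IsQueryProgram P) (D' : Instance S U)
    (d t f s : Interp S U) :
    ∃ q : Interp A U, StableOn id {q | q ∈ queryPreds S A} (queryProgram P)
      (Interp.combine d t f s D'.ext q) := by
  obtain ⟨M, hM, -⟩ := existsUnique_stableModel_facts_append hP D'
  obtain ⟨hext, hstab⟩ := (stableModel_facts_append_iff hP).1 hM
  refine ⟨fun a => M (.inr a), stableOn_queryProgram_iff.2 ?_⟩
  convert hstab
  funext q
  rcases q with p | a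
  · exact (hext p).symm
  · rfl

/-- In the stable models of the query program over an instance, the answer predicate consists of
the answers to the query. -/
theorem mem_answer_iff (hP : IsQueryProgram P) {ans : A.Pred} {Q : Query S A ans U}
    (hQ : Q.RepresentedBy P) {D' : Instance S U} {I : Interp (cqaSig S A) U}
    (hss : ∀ p, I (.ss p) = D'.ext p)
    (hI : StableOn id {q | q ∈ queryPreds S A} (queryProgram P) I) {b : Fin (A.arity ans) → U} :
    b ∈ I (.idb ans) ↔ Q.Holds D' b := by
  have hstab := (stableModel_facts_append_iff (D := D') hP).2
    ⟨hss, stableOn_queryProgram_iff.1 hI⟩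
  rw [Query.holds_iff_datalogAnswer hQ]
  exact ⟨fun h M hM => (existsUnique_stableModel_facts_append hP D').unique hstab hM ▸ h,
    fun h => h _ hstab⟩

end Answers

/-! ### The combined program -/

section Combined

variable {S A : Sig.{v}} [Fintype S.Pred] {U : Type u}

theorem mem_repairProgram {IC : List (UIC S U)} {r : Rule (cqaSig S A) U} :
    r ∈ repairProgram A IC ↔
      (∃ κ ∈ IC, ∃ J, κ.repairRule A J = r) ∨ ∃ p, r ∈ annotationRules A U p := by
  simp only [repairProgram, List.mem_append, List.mem_flatMap, List.mem_map, Finset.mem_toList,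
    Finset.mem_univ, true_and]

theorem mem_repairPreds_of_mem_head {IC : List (UIC S U)} {r : Rule (cqaSig S A) U}
    (hr : r ∈ repairProgram A IC) {a : Atom (cqaSig S A) U (Fin r.nvars)} (ha : a ∈ r.head) :
    a.pred ∈ repairPreds S A := by
  rcases mem_repairProgram.1 hr with ⟨κ, -, J, rfl⟩ | ⟨p, hp⟩
  · rcases List.mem_append.1 ha with ha | ha <;> obtain ⟨a', -, rfl⟩ := List.mem_map.1 ha <;>
      exact mem_repairPreds.2 ⟨fun _ h => (by cases h), fun _ h => (by cases h)⟩
  · simp only [annotationRules, List.mem_cons, List.not_mem_nil, or_false] at hp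
    rcases hp with rfl | rfl | rfl | rfl
    case inr.inr.inr => exact (List.not_mem_nil ha).elim
    all_goals
      obtain rfl := List.mem_singleton.1 ha
      exact mem_repairPreds.2 ⟨fun _ h => (by cases h), fun _ h => (by cases h)⟩

theorem ne_idb_of_mem_pos {IC : List (UIC S U)} {r : Rule (cqaSig S A) U}
    (hr : r ∈ repairProgram A IC) {a : Atom (cqaSig S A) U (Fin r.nvars)} (ha : a ∈ r.pos)
    (x : A.Pred) : a.pred ≠ .idb x := by
  rcases mem_repairProgram.1 hr with ⟨κ, -, J, rfl⟩ | ⟨p, hp⟩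
  · rcases List.mem_append.1 ha with ha | ha <;> obtain ⟨a', -, rfl⟩ := List.mem_map.1 ha <;>
      exact fun h => (by cases h)
  · simp only [annotationRules, List.mem_cons, List.not_mem_nil, or_false] at hp
    rcases hp with rfl | rfl | rfl | rfl
    case inr.inr.inr =>
      rcases List.mem_cons.1 ha with rfl | ha
      · exact fun h => (by cases h)
      · obtain rfl := List.mem_singleton.1 ha
        exact fun h => (by cases h)
    all_goals
      obtain rfl := List.mem_singleton.1 ha
      exact fun h => (by cases h)

theorem safe_of_mem_repairProgram {IC : List (UIC S U)} (hIC : ∀ κ ∈ IC, κ.Safe)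
    {r : Rule (cqaSig S A) U} (hr : r ∈ repairProgram A IC) : r.Safe := by
  rcases mem_repairProgram.1 hr with ⟨κ, hκ, J, rfl⟩ | ⟨p, hp⟩
  · intro x
    obtain ⟨a, ha, i, hi⟩ := hIC κ hκ x
    exact ⟨a.st, List.mem_append_left _ (List.mem_map_of_mem ha), i, hi⟩
  · simp only [annotationRules, List.mem_cons, List.not_mem_nil, or_false] at hp
    rcases hp with rfl | rfl | rfl | rfl <;> intro x <;>
      exact ⟨_, List.mem_cons_self, x, rfl⟩

theorem consts_subset_of_mem_repairProgram {IC : List (UIC S U)} {C : Set U}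
    (hC : ∀ κ ∈ IC, κ.consts ⊆ C) {r : Rule (cqaSig S A) U} (hr : r ∈ repairProgram A IC) :
    r.consts ⊆ C := by
  rcases mem_repairProgram.1 hr with ⟨κ, hκ, J, rfl⟩ | ⟨p, hp⟩
  · refine subset_trans (fun c hc => ?_) (hC κ hκ)
    rcases hc with ⟨a, ha, hc⟩ | ⟨a, ha, hc⟩ | ⟨a, ha, hc⟩ | ⟨b, hb, hc⟩
    · rcases List.mem_append.1 ha with ha | ha <;> obtain ⟨a', ha', rfl⟩ := List.mem_map.1 ha
      · exact .inl ⟨a', ha', hc⟩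
      · exact .inr (.inl ⟨a', ha', hc⟩)
    · rcases List.mem_append.1 ha with ha | ha <;> obtain ⟨a', ha', rfl⟩ := List.mem_map.1 ha
      · exact .inl ⟨a', ha', hc⟩
      · exact .inr (.inl ⟨_, List.get_mem _ a', hc⟩)
    · obtain ⟨j, -, rfl⟩ := List.mem_map.1 ha
      exact .inr (.inl ⟨_, List.get_mem _ j, hc⟩)
    · obtain ⟨b', hb', rfl⟩ := List.mem_map.1 hb
      refine .inr (.inr ⟨b', hb', ?_⟩)
      cases b' <;> exact hc
  · have hgen : ∀ {a : Atom (cqaSig S A) U (Fin (S.arity p))},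
        a = (genAtom U p).db ∨ a = (genAtom U p).tr ∨ a = (genAtom U p).fa ∨
          a = (genAtom U p).st ∨ a = (genAtom U p).ss → ∀ c, c ∉ a.consts := by
      rintro a (rfl | rfl | rfl | rfl | rfl) c ⟨i, hi⟩ <;> cases hi
    simp only [annotationRules, List.mem_cons, List.not_mem_nil, or_false] at hp
    rintro c (⟨a, ha, hc⟩ | ⟨a, ha, hc⟩ | ⟨a, ha, hc⟩ | ⟨b, hb, hc⟩) <;>
      rcases hp with rfl | rfl | rfl | rfl <;>
      simp only [List.mem_cons, List.not_mem_nil, or_false] at * <;>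
      exact (hgen (by tauto) c hc).elim

theorem safe_of_mem_cqaProgram {D : Instance S U} {IC : List (UIC S U)} (hIC : ∀ κ ∈ IC, κ.Safe)
    {P : Program (S.sum A) U} (hP : IsQueryProgram P) {r : Rule (cqaSig S A) U}
    (hr : r ∈ cqaProgram D IC P) : r.Safe := by
  rcases List.mem_append.1 hr with hr | hr
  · rcases List.mem_append.1 hr with hr | hr
    · obtain ⟨p, t, -, rfl⟩ := mem_facts_map.1 hr
      exact fun x => x.elim0
    · exact safe_of_mem_repairProgram hIC hr
  · obtain ⟨r', hr', rfl⟩ := List.mem_map.1 hr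
    intro x
    obtain ⟨a, ha, i, hi⟩ := hP.2.1 r' hr' x
    refine ⟨a.starred, List.mem_map_of_mem ha, ?_⟩
    rcases a with ⟨p | a, ts⟩ <;> exact ⟨i, hi⟩

theorem consts_subset_of_mem_cqaProgram {D : Instance S U} {IC : List (UIC S U)}
    {P : Program (S.sum A) U} {C : Set U} (hD : D.adom ⊆ C) (hIC : ∀ κ ∈ IC, κ.consts ⊆ C)
    (hP : ∀ r ∈ P, r.consts ⊆ C) {r : Rule (cqaSig S A) U} (hr : r ∈ cqaProgram D IC P) :
    r.consts ⊆ C := by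
  rcases List.mem_append.1 hr with hr | hr
  · rcases List.mem_append.1 hr with hr | hr
    · obtain ⟨p, t, ht, rfl⟩ := mem_facts_map.1 hr
      rintro c (⟨a, ha, hc⟩ | ⟨a, ha, hc⟩ | ⟨a, ha, hc⟩ | ⟨b, hb, hc⟩)
      · obtain rfl := List.mem_singleton.1 ha
        obtain ⟨i, hi⟩ := hc
        exact hD ⟨p, t, ht, i, Term.cst.inj hi⟩
      · exact (List.not_mem_nil ha).elim
      · exact (List.not_mem_nil ha).elim
      · exact (List.not_mem_nil hb).elim
    · exact consts_subset_of_mem_repairProgram hIC hr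
  · obtain ⟨r', hr', rfl⟩ := List.mem_map.1 hr
    refine subset_trans (fun c hc => ?_) (hP r' hr')
    rcases hc with ⟨a, ha, hc⟩ | ⟨a, ha, hc⟩ | ⟨a, ha, hc⟩ | ⟨b, hb, hc⟩
    · obtain ⟨a', ha', rfl⟩ := List.mem_map.1 ha
      exact .inl ⟨a', ha', a'.consts_starred ▸ hc⟩
    · obtain ⟨a', ha', rfl⟩ := List.mem_map.1 ha
      exact .inr (.inl ⟨a', ha', a'.consts_starred ▸ hc⟩)
    · obtain ⟨a', ha', rfl⟩ := List.mem_map.1 ha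
      exact .inr (.inr (.inl ⟨a', ha', a'.consts_starred ▸ hc⟩))
    · exact .inr (.inr (.inr ⟨b, hb, hc⟩))

variable [Fintype A.Pred]

theorem mem_allPreds (q : CQAPred S A) : q ∈ allPreds S A := by
  by_cases hq : ∃ a, q = .idb a
  · exact List.mem_append_right _ (mem_queryPreds.2 hq)
  refine List.mem_append_left _ ?_
  by_cases hq' : ∃ p, q = .db p
  · obtain ⟨p, rfl⟩ := hq'
    exact List.mem_append_left _ (List.mem_map_of_mem (f := fun p : S.Pred => CQAPred.db p)
      (Finset.mem_toList.2 (Finset.mem_univ p)))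
  · push Not at hq hq'
    exact List.mem_append_right _ (mem_repairPreds.2 ⟨hq', hq⟩)

theorem allPreds_eq_univ : {q | q ∈ allPreds S A} = Set.univ :=
  Set.eq_univ_of_forall mem_allPreds

/-- The combined program splits into the facts, the repair program and the query program. -/
theorem stableOn_cqaProgram_iff {M : Type*} {k : U → M} {D : Instance S U} {IC : List (UIC S U)}
    {P : Program (S.sum A) U} (hP : IsQueryProgram P) {I : Interp (cqaSig S A) M} :
    StableOn k Set.univ (cqaProgram D IC P) I ↔
      (∀ p, I (.db p) = D.eval k p) ∧
        StableOn k {q | q ∈ repairPreds S A} (repairProgram A IC) I ∧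
          StableOn k {q | q ∈ queryPreds S A} (queryProgram P) I := by
  have hl : (Set.univ : Set (cqaSig S A).Pred) =
      (Set.range CQAPred.db ∪ {q | q ∈ repairPreds S A}) ∪ {q | q ∈ queryPreds S A} := by
    refine (Set.eq_univ_of_forall fun q => ?_).symm
    rcases List.mem_append.1 (mem_allPreds q) with hq | hq
    · rcases List.mem_append.1 hq with hq | hq
      · obtain ⟨p, -, hp⟩ := List.mem_map.1 hq
        exact .inl (.inl ⟨p, hp⟩)
      · exact .inl (.inr hq)
    · exact .inr hq
  have hfact : ∀ r ∈ D.facts.map (Rule.map (Atom.db (A := A))), ∀ a ∈ r.head,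
      ∃ p, a.pred = CQAPred.db p := by
    intro r hr a ha
    obtain ⟨p, t, -, rfl⟩ := mem_facts_map.1 hr
    obtain rfl := List.mem_singleton.1 ha
    exact ⟨p, rfl⟩
  have hfact' : ∀ r ∈ D.facts.map (Rule.map (Atom.db (A := A))), r.pos = [] := by
    intro r hr
    obtain ⟨p, t, -, rfl⟩ := mem_facts_map.1 hr
    rfl
  have hquery : ∀ r ∈ queryProgram P, ∀ a ∈ r.head, ∃ b, a.pred = CQAPred.idb b := by
    intro r hr a ha
    obtain ⟨r', hr', rfl⟩ := List.mem_map.1 hr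
    obtain ⟨a', ha', rfl⟩ := List.mem_map.1 ha
    obtain ⟨h, hh, b, hb⟩ := hP.1 r' hr'
    rw [hh, List.mem_singleton] at ha'
    subst ha'
    rcases a' with ⟨p | x, ts⟩
    · cases hb
    · exact ⟨x, rfl⟩
  have hrest : StableOn k (Set.range CQAPred.db ∪ {q | q ∈ repairPreds S A})
      (D.facts.map (Rule.map Atom.db) ++ repairProgram A IC) I ↔ _ :=
    (stableOn_append ?_ ?_ ?_).trans (and_congr_left' stableOn_facts_db)
  · rw [hl, ← and_assoc]
    refine (stableOn_append ?_ ?_ ?_).trans (and_congr_left' hrest)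
    · intro r hr a ha h
      obtain ⟨x, hx⟩ := mem_queryPreds.1 h
      rcases List.mem_append.1 hr with hr | hr
      · obtain ⟨p, hp⟩ := hfact r hr a ha
        cases hp.symm.trans hx
      · exact (mem_repairPreds.1 (mem_repairPreds_of_mem_head hr ha)).2 x hx
    · intro r hr a ha h
      obtain ⟨b, hb⟩ := hquery r hr a ha
      rcases h with ⟨p, hp⟩ | h
      · cases hp.trans hb
      · exact idb_notMem_repairPreds b (hb ▸ h)
    · intro r hr a ha h
      obtain ⟨x, hx⟩ := mem_queryPreds.1 h
      rcases List.mem_append.1 hr with hr | hr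
      · rw [hfact' r hr] at ha
        exact List.not_mem_nil ha
      · exact ne_idb_of_mem_pos hr ha x hx
  · intro r hr a ha h
    obtain ⟨p, hp⟩ := hfact r hr a ha
    exact db_notMem_repairPreds p (hp ▸ h)
  · rintro r hr a ha ⟨p, hp⟩
    exact (mem_repairPreds.1 (mem_repairPreds_of_mem_head hr ha)).1 p hp.symm
  · intro r hr a ha
    rw [hfact' r hr] at ha
    exact (List.not_mem_nil ha).elim

end Combined

/-! ### Consistent query answers -/

section Main

variable {S A : Sig.{v}} {U : Type u}

theorem models_ansFormula {M : Type*} [Nonempty M] {I : Struct (cqaSig S A) U M} {ans : A.Pred}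
    {b : Fin (A.arity ans) → U} :
    I.Models (ansFormula S ans b) ↔ I.cst ∘ b ∈ I.rel (CQAPred.idb ans) :=
  ⟨fun h => h (fun _ => Classical.arbitrary M) I.rel, fun h _ _ => h⟩

variable [Fintype S.Pred] [Fintype A.Pred]
  {D : Instance S U} {IC : List (UIC S U)} {P : Program (S.sum A) U}

theorem models_theory_iff {M : Type*} [Nonempty M] (hP : IsQueryProgram P)
    {I : Struct (cqaSig S A) U M} :
    I.Models (completion A D) ∧ I.Models (PhiRepair A IC) ∧ I.Models (PhiQuery P) ↔
      StableOn I.cst Set.univ (cqaProgram D IC P) I.rel := by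
  rw [models_completion, PhiRepair, PhiQuery, models_Phi_iff, models_Phi_iff,
    stableOn_cqaProgram_iff hP]

theorem models_PhiCQA_iff {M : Type*} [Nonempty M] {I : Struct (cqaSig S A) U M} :
    I.Models (PhiCQA D IC P) ↔ StableOn I.cst Set.univ (cqaProgram D IC P) I.rel := by
  rw [PhiCQA, models_Phi_iff, allPreds_eq_univ]

/-- Consistent answers in terms of the Herbrand stable models of the combined program. -/
theorem consistentAnswer_iff_stableModel (hIC : ∀ κ ∈ IC, κ.Safe) {ans : A.Pred}
    {Q : Query S A ans U} (hP : IsQueryProgram P) (hQ : Q.RepresentedBy P)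
    {b : Fin (A.arity ans) → U} :
    ConsistentAnswer IC D Q b ↔
      ∀ I : Interp (cqaSig S A) U, StableOn id Set.univ (cqaProgram D IC P) I →
        b ∈ I (.idb ans) := by
  constructor
  · intro h I hI
    obtain ⟨hdb, hrep, hquery⟩ := (stableOn_cqaProgram_iff hP).1 hI
    rw [D.eval_id] at hdb
    obtain ⟨D', hD', heq⟩ := (stableOn_repairProgram_iff hIC hdb).1 hrep
    exact (mem_answer_iff hP hQ (fun p => congrFun heq (.ss p)) hquery).2 (h D' hD')
  · intro h D' hD'
    obtain ⟨q, hq⟩ := exists_stableOn_queryProgram hP D' D.ext (fun p => D'.ext p \ D.ext p)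
      (fun p => D.ext p \ D'.ext p) (fun p => D.ext p ∪ D'.ext p)
    refine (mem_answer_iff hP hQ (fun p => rfl) hq).1 (h _ ((stableOn_cqaProgram_iff hP).2
      ⟨fun p => ?_, (stableOn_repairProgram_iff hIC fun p => rfl).2 ⟨D', hD', rfl⟩, hq⟩))
    rw [D.eval_id]
    rfl

theorem herbrandEntails_iff [Nonempty U] (hP : IsQueryProgram P) {ans : A.Pred}
    {b : Fin (A.arity ans) → U} :
    HerbrandEntails {completion A D, PhiRepair A IC, PhiQuery P} (ansFormula S ans b) ↔
      ∀ I : Interp (cqaSig S A) U, StableOn id Set.univ (cqaProgram D IC P) I →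
        b ∈ I (.idb ans) := by
  refine forall_congr' fun I => ?_
  simp only [Set.mem_insert_iff, Set.mem_singleton_iff, forall_eq_or_imp, forall_eq]
  rw [models_theory_iff hP, models_ansFormula]
  rfl

/-- With domain closure and unique names for a set `C` that contains the relevant constants, every
model is isomorphic to the restriction of a Herbrand structure to `C`; conversely the stable models
of the combined program live on `C`. -/
theorem entails_iff (hIC : ∀ κ ∈ IC, κ.Safe) (hP : IsQueryProgram P) {C : Finset U}
    (hC : C.Nonempty) (hDC : D.adom ⊆ C) (hICC : ∀ κ ∈ IC, κ.consts ⊆ C)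
    (hPC : ∀ r ∈ P, r.consts ⊆ C) {ans : A.Pred} {b : Fin (A.arity ans) → U} (hb : ∀ i, b i ∈ C) :
    Entails {reiter A C D, PhiRepair A IC, PhiQuery P} (ansFormula S ans b) ↔
      ∀ I : Interp (cqaSig S A) U, StableOn id Set.univ (cqaProgram D IC P) I →
        b ∈ I (.idb ans) := by
  classical
  have hsafe : ∀ r ∈ cqaProgram D IC P, r.Safe := fun r => safe_of_mem_cqaProgram hIC hP
  have hconsts : ∀ r ∈ cqaProgram D IC P, r.consts ⊆ C := fun r =>
    consts_subset_of_mem_cqaProgram hDC hICC hPC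
  simp only [Entails, Set.mem_insert_iff, Set.mem_singleton_iff, forall_eq_or_imp, forall_eq,
    reiter, models_and, and_assoc]
  constructor
  · intro h J hJ
    -- The constants outside `C` do not occur; they may denote any element.
    let e : {c // c ∈ C} → U := Subtype.val
    let k : U → {c // c ∈ C} := fun c => if hc : c ∈ C then ⟨c, hc⟩ else ⟨_, hC.choose_spec⟩
    have hk : ∀ c ∈ C, e (k c) = c := fun c hc => by simp [e, k, hc]
    have : Nonempty {c // c ∈ C} := hC.to_subtype
    obtain ⟨I, rfl⟩ := Interp.exists_map_eq (e := e) (J := J) fun p t ht i =>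
      ⟨⟨t i, hJ.mem_of_safe hsafe hconsts p t ht i⟩, rfl⟩
    have hI := (stableOn_map Subtype.val_injective hsafe
      (fun r hr c hc => hk c (hconsts r hr hc))).1 hJ
    have hans := models_ansFormula.1 (h {c // c ∈ C} ⟨k, I⟩ ⟨models_DCA.2 fun m => ⟨m, m.2, ?_⟩,
      models_UNA.2 fun c hc d hd hcd => ?_,
      (models_theory_iff hP).2 hI⟩)
    · exact ⟨k ∘ b, hans, funext fun i => hk _ (hb i)⟩
    · exact Subtype.ext (hk m m.2).symm
    · rw [← hk c hc, ← hk d hd]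
      exact congrArg e hcd
  · intro h M _ I ⟨hdca, huna, hI⟩
    rw [models_DCA] at hdca
    rw [models_UNA] at huna
    choose e heC he using hdca
    have hinj : Function.Injective e := fun m n hmn => (he m).trans (hmn ▸ (he n).symm)
    have hk : ∀ c ∈ C, e (I.cst c) = c := fun c hc => huna (heC _) hc (he _).symm
    obtain ⟨s, hs, hsb⟩ := h _ ((stableOn_map (k' := id) hinj hsafe
      fun r hr c hc => hk c (hconsts r hr hc)).2 ((models_theory_iff hP).1 hI))
    obtain rfl : I.cst ∘ b = s := by
      rw [← hsb]
      exact funext fun i => (he (s i)).symm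
    exact models_ansFormula.2 hs

end Main

end CQA

theorem proposition3 {U : Type u} [Nonempty U] {S A : Sig.{v}} [Fintype S.Pred] [Fintype A.Pred]
    (D : Instance S U) (IC : List (UIC S U)) (hIC : ∀ κ ∈ IC, κ.Safe)
    (ans : A.Pred) (Q : Query S A ans U) (P : Program (S.sum A) U) (hP : IsQueryProgram P)
    (hQ : Q.RepresentedBy P) :
    -- consistent answers as second-order consequences, and decomposition of `Φ(Π)`
    (∀ C : Finset U, C.Nonempty → D.adom ⊆ C → (∀ κ ∈ IC, κ.consts ⊆ C) →
      (∀ r ∈ P, r.consts ⊆ C) →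
      (∀ b : Fin (A.arity ans) → U, (∀ i, b i ∈ C) →
        (ConsistentAnswer IC D Q b ↔
          Entails {reiter A C D, PhiRepair A IC, PhiQuery P} (ansFormula S ans b))) ∧
      (∀ (M : Type u) [Nonempty M] (I : Struct (cqaSig S A) U M),
        (I.Models (DCA _ C) ∧ I.Models (UNA _ C) ∧ I.Models (PhiCQA D IC P)) ↔
          (I.Models (reiter A C D) ∧ I.Models (PhiRepair A IC) ∧ I.Models (PhiQuery P)))) ∧
    -- the same relative to Herbrand structures, without domain closure and unique names
    (∀ b : Fin (A.arity ans) → U,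
      (ConsistentAnswer IC D Q b ↔
        HerbrandEntails {completion A D, PhiRepair A IC, PhiQuery P} (ansFormula S ans b))) ∧
    -- `Φ(Π^r)` specifies the repairs, for fixed extensional predicates
    (∀ R : Interp S U,
      (∃ I : Interp (cqaSig S A) U, (∀ p, I (CQAPred.db p) = D.ext p) ∧
        (herbrand I).Models (PhiRepair A IC) ∧ ∀ p, I (CQAPred.ss p) = R p) ↔
      ∃ D' ∈ Repairs D IC, D'.ext = R) ∧
    -- `Φ(Π^Q)` specifies the query answers, for fixed predicates `P_⋆⋆`
    (∀ D' : Instance S U,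
      (∃ I : Interp (cqaSig S A) U, (∀ p, I (CQAPred.ss p) = D'.ext p) ∧
        (herbrand I).Models (PhiQuery P)) ∧
      ∀ I : Interp (cqaSig S A) U, (∀ p, I (CQAPred.ss p) = D'.ext p) →
        (herbrand I).Models (PhiQuery P) →
        ∀ b : Fin (A.arity ans) → U, b ∈ I (CQAPred.idb ans) ↔ Q.Holds D' b) := by
  refine ⟨fun C hC hDC hICC hPC => ⟨fun b hb => ?_, fun M _ I => ?_⟩, fun b => ?_, fun R => ?_,
    fun D' => ⟨?_, fun I hss hI b => ?_⟩⟩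
  · rw [consistentAnswer_iff_stableModel hIC hP hQ, entails_iff hIC hP hC hDC hICC hPC hb]
  · rw [models_PhiCQA_iff, reiter, models_and, models_and, ← models_theory_iff hP]
    tauto
  · rw [consistentAnswer_iff_stableModel hIC hP hQ, herbrandEntails_iff hP]
  · constructor
    · rintro ⟨I, hdb, hI, hss⟩
      obtain ⟨D', hD', heq⟩ := (stableOn_repairProgram_iff hIC hdb).1 (models_Phi_iff.1 hI)
      exact ⟨D', hD', funext fun p => (congrFun heq (.ss p)).symm.trans (hss p)⟩
    · rintro ⟨D', hD', rfl⟩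
      refine ⟨Interp.combine D.ext (fun p => D'.ext p \ D.ext p) (fun p => D.ext p \ D'.ext p)
        (fun p => D.ext p ∪ D'.ext p) D'.ext fun _ => ∅, fun p => rfl, ?_, fun p => rfl⟩
      exact models_Phi_iff.2 ((stableOn_repairProgram_iff hIC fun p => rfl).2 ⟨D', hD', rfl⟩)
  · obtain ⟨q, hq⟩ := exists_stableOn_queryProgram hP D' ⊥ ⊥ ⊥ ⊥
    exact ⟨_, fun p => rfl, models_Phi_iff.2 hq⟩
  · exact mem_answer_iff hP hQ hss (models_Phi_iff.1 hI)
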